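/- Let $m,d\ge 0$ be integers and $p>0$, and let $\sigma:\mathbb R\to\mathbb R$ be positively $p$-homogeneous, i.e. $\sigma(ct)=c^p\sigma(t)$ for all $c>0$, $t\in\mathbb R$. For $\theta=((a_1,w_1),\dots,(a_m,w_m))\in\Theta:=(\mathbb R\times\mathbb R^d)^m$ let $f_\theta(x)=\sum_{i=1}^m a_i\,\sigma(w_i^\top x)$. Let $\mathcal F$ be a Hausdorff real topological vector space and let $J$ be a linear map from $\operatorname{span}\{x\mapsto\sigma(w^\top x):w\in\mathbb R^d\}$ to $\mathcal F$ by which functions are regarded as elements of $\mathcal F$ (for instance an inclusion, the passage to classes modulo almost everywhere equality, or the restriction to a finite sample). The realization map is $\Phi:\Theta\to\mathcal F$, $\Phi(\theta)=J(f_\theta)$. Let $G=S_m\ltimes(\mathbb R_{>0})^m$ act on $\Theta$ by permuting the $m$ neurons $(a_i,w_i)$ and by the rescalings $(a_i,w_i)\mapsto(c_i^{-p}a_i,c_iw_i)$, $c\in(\mathbb R_{>0})^m$. Let $T_\theta(G\cdot\theta)$ be the set of velocities at $\theta$ of smooth curves $\gamma:\mathbb R\to\Theta$ with $\gamma(0)=\theta$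 whose values all lie in the orbit $G\cdot\theta$. Let $\Theta_{\mathrm{reg}}$ be the set of all $\theta\in\Theta$ at which $\Phi$ is differentiable, $\ker D\Phi_\theta=T_\theta(G\cdot\theta)$, and the action is locally free (the stabilizer of $\theta$ is a discrete subgroup of $G$). **Proposition.** (1) For every $\theta\in\Theta_{\mathrm{reg}}$, $$\ker D\Phi_\theta=T_\theta(G\cdot\theta)=\bigl\{\bigl((-p\xi_1a_1,\xi_1w_1),\dots,(-p\xi_ma_m,\xi_mw_m)\bigr):\xi\in\mathbb R^m\bigr\}.$$ (2) $\Theta_{\mathrm{reg}}$ is $G$-invariant. (3) Assume that $\Phi$ is continuously differentiable on an open set containing $\Theta_{\mathrm{reg}}$. Then $\Theta_{\mathrm{reg}}$ is open in $\Theta$, and the orbit space $\Theta_{\mathrm{reg}}/G$ with the quotient topology is second countable, is Hausdorff if the action of $G$ on $\Theta_{\mathrm{reg}}$ is proper, and carries a structure of smooth ($C^\infty$) manifold of dimension $md$, in the sense of a space with a smooth atlas (not necessarily Hausdorff), for which the quotient map $q:\Theta_{\mathrm{reg}}\to\Theta_{\mathrm{reg}}/G$ is a smooth submersion. For every such structure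 and every $\theta\in\Theta_{\mathrm{reg}}$ there is exactly one linear isomorphism $$L:T_{[\theta]}(\Theta_{\mathrm{reg}}/G)\to\operatorname{Im}D\Phi_\theta\qquad\text{with}\qquad L(Dq_\theta[v])=D\Phi_\theta[v]\quad\text{for all }v\in\mathbb R^{m(d+1)}\cong\Theta .$$ Thus the quotient tangent space is canonically identified with the space $\operatorname{Im}D\Phi_\theta$ of first-order function variations. -/

import Mathlib

open scoped Manifold ContDiff Topology

/-- The parameter space `Θ = (ℝ × ℝᵈ)ᵐ`; `(θ i).1 = aᵢ` and `(θ i).2 = wᵢ`. -/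
abbrev Param (m d : ℕ) : Type := Fin m → ℝ × EuclideanSpace ℝ (Fin d)

/-! ### The symmetry group `G = Sₘ ⋉ (ℝ_{>0})ᵐ` and its action -/

/-- The multiplicative group of positive real numbers. -/
abbrev PosReal : Type := {c : ℝ // 0 < c}

/-- `Sₘ` acts on `(ℝ_{>0})ᵐ` by relabelling coordinates: `(π · c) i = c (π⁻¹ i)`. -/
def permAut (m : ℕ) : Equiv.Perm (Fin m) →* MulAut (Fin m → PosReal) where
  toFun π :=
    { toFun := fun c i => c (π⁻¹ i)
      invFun := fun c i => c (π i)
      left_inv := fun c => by ext i; simp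
      right_inv := fun c => by ext i; simp
      map_mul' := fun c c' => rfl }
  map_one' := rfl
  map_mul' := fun π ρ => by ext c i; simp

/-- The symmetry group `G = Sₘ ⋉ (ℝ_{>0})ᵐ`. -/
abbrev SymGroup (m : ℕ) : Type := (Fin m → PosReal) ⋊[permAut m] Equiv.Perm (Fin m)

/-- The Lie group topology of `G`: the product of the usual topology of `(ℝ_{>0})ᵐ` and the
discrete topology of `Sₘ` (seen inside the finite discrete space `Fin m → Fin m`). -/
instance instTopologicalSpaceSymGroup (m : ℕ) : TopologicalSpace (SymGroup m) :=
  TopologicalSpace.induced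
    (fun g => ((g.left, fun i => g.right i) : (Fin m → PosReal) × (Fin m → Fin m))) inferInstance

/-- `(c, π) · θ = c · (π · θ)`, where `π` permutes the neurons and `c` rescales the `i`-th neuron
to `(cᵢ⁻ᵖ aᵢ, cᵢ wᵢ)`. -/
noncomputable def symAct {m d : ℕ} (p : ℝ) (g : SymGroup m) (θ : Param m d) : Param m d :=
  fun i => ((g.left i : ℝ) ^ (-p) * (θ (g.right⁻¹ i)).1, (g.left i : ℝ) • (θ (g.right⁻¹ i)).2)

/-- The action of `G` on `Θ` by permutation and neuronwise positive rescaling. -/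
noncomputable abbrev symMulAction (m d : ℕ) (p : ℝ) : MulAction (SymGroup m) (Param m d) where
  smul := symAct p
  one_smul θ := by
    funext i
    change symAct p 1 θ i = θ i
    simp [symAct]
  mul_smul g h θ := by
    funext i
    change symAct p (g * h) θ i = symAct p g (symAct p h θ) i
    simp only [symAct, SemidirectProduct.mul_left, SemidirectProduct.mul_right, Pi.mul_apply,
      Positive.val_mul, mul_inv_rev, Equiv.Perm.mul_apply, smul_smul]
    rw [Real.mul_rpow (g.left i).2.le (((permAut m) g.right h.left) i).2.le, mul_assoc]
    rfl

/-- The orbit `G · θ`. -/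
def symOrbit {m d : ℕ} (p : ℝ) (θ : Param m d) : Set (Param m d) :=
  letI := symMulAction m d p
  MulAction.orbit (SymGroup m) θ

/-- The tangent space `T_θ(G · θ)`: the velocities at `θ` of the smooth curves in `Θ` that stay
in the orbit of `θ`. -/
def orbitTangent {m d : ℕ} (p : ℝ) (θ : Param m d) : Set (Param m d) :=
  {v | ∃ γ : ℝ → Param m d, ContDiff ℝ ∞ γ ∧ (∀ t, γ t ∈ symOrbit p θ) ∧ γ 0 = θ ∧
    HasDerivAt γ v 0}

/-- The vector `δ_ξ θ = ((-p ξᵢ aᵢ, ξᵢ wᵢ))ᵢ`. -/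
def scalingDirection {m d : ℕ} (p : ℝ) (θ : Param m d) (ξ : Fin m → ℝ) : Param m d :=
  fun i => (-p * ξ i * (θ i).1, ξ i • (θ i).2)

/-- The action is locally free at `θ`: the isotropy group of `θ` is a discrete subgroup of `G`. -/
def LocallyFreeAt {m d : ℕ} (p : ℝ) (θ : Param m d) : Prop :=
  letI := symMulAction m d p
  DiscreteTopology (MulAction.stabilizer (SymGroup m) θ)

/-! ### The network and its realization map -/

/-- `σ` is positively `p`-homogeneous. -/
def PosHomogeneous (p : ℝ) (σ : ℝ → ℝ) : Prop := ∀ c t : ℝ, 0 < c → σ (c * t) = c ^ p * σ t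

/-- The feature function `x ↦ σ(wᵀ x)`. -/
noncomputable def feature {d : ℕ} (σ : ℝ → ℝ) (w : EuclideanSpace ℝ (Fin d)) :
    EuclideanSpace ℝ (Fin d) → ℝ :=
  fun x => σ (inner ℝ w x)

/-- The shallow network `f_θ(x) = ∑ᵢ aᵢ σ(wᵢᵀ x)`. -/
noncomputable def network {m d : ℕ} (σ : ℝ → ℝ) (θ : Param m d) : EuclideanSpace ℝ (Fin d) → ℝ :=
  fun x => ∑ i, (θ i).1 * σ (inner ℝ (θ i).2 x)

/-- The linear span of the feature functions `x ↦ σ(wᵀ x)`, `w ∈ ℝᵈ`. -/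
def featureSpan (d : ℕ) (σ : ℝ → ℝ) : Submodule ℝ (EuclideanSpace ℝ (Fin d) → ℝ) :=
  Submodule.span ℝ (Set.range (feature σ))

theorem network_mem_featureSpan {m d : ℕ} (σ : ℝ → ℝ) (θ : Param m d) :
    network σ θ ∈ featureSpan d σ := by
  have h : network σ θ = ∑ i, (θ i).1 • feature σ (θ i).2 := by
    funext x
    simp [network, feature]
  rw [h]
  exact Submodule.sum_mem _ fun i _ =>
    Submodule.smul_mem _ _ (Submodule.subset_span ⟨(θ i).2, rfl⟩)

/-- The realization map `Φ : Θ → 𝓕`, `Φ(θ) = f_θ`. The linear map `J` says how functions are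
regarded as elements of `𝓕`: it may be an inclusion into a space of functions, the passage to
classes of almost everywhere equal functions, or the restriction to a finite sample. -/
noncomputable def realization {d : ℕ} {F : Type*} [AddCommGroup F] [Module ℝ F] {σ : ℝ → ℝ}
    (J : featureSpan d σ →ₗ[ℝ] F) (m : ℕ) (θ : Param m d) : F :=
  J ⟨network σ θ, network_mem_featureSpan σ θ⟩

/-- The regular set: `DΦ_θ` exists, its kernel is the tangent space of the orbit, and the action
is locally free at `θ`. -/
def regularSet {d : ℕ} {F : Type*} [AddCommGroup F] [Module ℝ F] [TopologicalSpace F]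
    {σ : ℝ → ℝ} (p : ℝ) (J : featureSpan d σ →ₗ[ℝ] F) (m : ℕ) : Set (Param m d) :=
  {θ | DifferentiableAt ℝ (realization J m) θ ∧
    {v | fderiv ℝ (realization J m) θ v = 0} = orbitTangent p θ ∧ LocallyFreeAt p θ}

/-- `Φ` is continuously differentiable on `U`. (As `Θ` is finite dimensional, continuity of
`θ ↦ DΦ_θ` means continuity of `θ ↦ DΦ_θ[v]` for each `v`.) -/
def ContinuouslyDifferentiableOn {m d : ℕ} {F : Type*} [AddCommGroup F] [Module ℝ F]
    [TopologicalSpace F] (Φ : Param m d → F) (U : Set (Param m d)) : Prop :=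
  (∀ θ ∈ U, DifferentiableAt ℝ Φ θ) ∧ ∀ v, ContinuousOn (fun θ => fderiv ℝ Φ θ v) U

/-! ### Orbit spaces -/

/-- Two points of `O` are equivalent when they lie in the same `G`-orbit. -/
noncomputable def orbitSetoid {m d : ℕ} (p : ℝ) (O : TopologicalSpace.Opens (Param m d)) : Setoid O :=
  letI := symMulAction m d p
  (MulAction.orbitRel (SymGroup m) (Param m d)).comap Subtype.val

/-- The orbit space `O / G` of an (invariant) open set of parameters. -/
def OrbitSpace {m d : ℕ} (p : ℝ) (O : TopologicalSpace.Opens (Param m d)) : Type :=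
  Quotient (orbitSetoid p O)

/-- The orbit space carries the quotient topology. -/
instance instTopologicalSpaceOrbitSpace {m d : ℕ} (p : ℝ)
    (O : TopologicalSpace.Opens (Param m d)) : TopologicalSpace (OrbitSpace p O) :=
  inferInstanceAs (TopologicalSpace (Quotient (orbitSetoid p O)))

/-- The quotient map `q : O → O / G`. -/
noncomputable def orbitMk {m d : ℕ} (p : ℝ) (O : TopologicalSpace.Opens (Param m d)) (θ : O) :
    OrbitSpace p O :=
  Quotient.mk (orbitSetoid p O) θ

/-- The model space of `O / G`, of dimension `dim Θ - dim G = m (d + 1) - m = m d`. -/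
abbrev QuotModel (m d : ℕ) : Type := EuclideanSpace ℝ (Fin (m * d))

/-- The given atlas on `O / G` is a quotient manifold structure: it is a smooth manifold
structure (on the quotient topology) for which the quotient map is a smooth submersion. -/
def IsQuotientManifold {m d : ℕ} (p : ℝ) (O : TopologicalSpace.Opens (Param m d))
    [ChartedSpace (QuotModel m d) (OrbitSpace p O)] : Prop :=
  IsManifold 𝓘(ℝ, QuotModel m d) ∞ (OrbitSpace p O) ∧
  ContMDiff 𝓘(ℝ, Param m d) 𝓘(ℝ, QuotModel m d) ∞ (orbitMk p O) ∧
  ∀ θ : O, Function.Surjective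
    (mfderiv 𝓘(ℝ, Param m d) 𝓘(ℝ, QuotModel m d) (orbitMk p O) θ)

/-- The action of `G` on `O` is proper: `(g, θ) ↦ (g · θ, θ)` is a proper map into `O × O`. -/
def ProperActionOn {m d : ℕ} (p : ℝ) (O : TopologicalSpace.Opens (Param m d)) : Prop :=
  IsProperMap (fun x : {x : SymGroup m × O // symAct p x.1 x.2.1 ∈ O} =>
    ((⟨symAct p x.1.1 x.1.2.1, x.2⟩, x.1.2) : O × O))

/-! ### Derivatives along curves with values in a topological vector space -/

open Filter Set

/-! Since `p ≠ 0`, a nonzero neuron determines the factor that rescales it, so local freeness means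
that no neuron vanishes (`locallyFreeAt_iff`). At such a point the scaling directions form an
`m`-dimensional space, and it is the whole orbit tangent space: a curve in the orbit has, near time
zero, each neuron on the scaling ray it started from, because permutations offer only finitely many
rays (`orbitTangent_eq_range`). Invariance of the regular set follows from that of `Φ`. For
openness, the kernel of `DΦ` always contains the scaling directions, and its dimension is upper
semicontinuous (`eventually_finrank_ker_le`).

A chart of the orbit space needs a local slice. Rescaling alone has explicit slices, which normalize
one coordinate of each neuron to `±1`; the obstacle is the permutations. Regularity removes it: if
`0 < d` and there are at least two neurons, all inner weights are nonzero and their directions are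
pairwise distinct (`inner_ne_zero_of_mem_regularSet`, `eq_of_direction_eq`). Otherwise two neurons
could be moved together, leaving the network unchanged, in a direction that is not a scaling. Near a
regular point the neurons are thus told apart by their directions, and the slice for rescaling is a
slice for `G` (`exists_orbitSlice_of_direction`). If `d = 0` the model space is a point.

Finally, for any quotient structure, `Dq` kills the scaling directions and is onto a space of
dimension `m d`, so its kernel has dimension `m` and equals that of `DΦ` (`ker_mfderiv_orbitMk`).
Two linear maps with the same kernel have canonically isomorphic images. -/

theorem HasFDerivAt.tendsto_slope_curve {E F : Type*} [NormedAddCommGroup E] [NormedSpace ℝ E]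
    [AddCommGroup F] [Module ℝ F] [TopologicalSpace F] [IsTopologicalAddGroup F]
    [ContinuousSMul ℝ F] {f : E → F} {f' : E →L[ℝ] F} {x : E} (h : HasFDerivAt f f' x)
    {γ : ℝ → E} {v : E} (hγ : HasDerivAt γ v 0) (h0 : γ 0 = x) :
    Tendsto (fun t => t⁻¹ • (f (γ t) - f x)) (𝓝[≠] 0) (𝓝 (f' v)) := by
  have h1 : Tendsto (fun t => γ t - x) (𝓝[≠] 0) (𝓝 0) := by
    have := (hγ.continuousAt.tendsto.mono_left (nhdsWithin_le_nhds (s := {0}ᶜ))).sub_const x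
    simpa [h0] using this
  have h2 : Tendsto (fun t : ℝ => t⁻¹ • (γ t - x)) (𝓝[≠] 0) (𝓝 v) := by
    have := hasDerivAt_iff_tendsto_slope_zero.1 hγ
    simpa [h0] using this
  have := (hasFDerivWithinAt_univ.2 h).lim h1 (by simp) h2
  simpa using this

theorem HasFDerivAt.apply_eq_zero_of_curve {E F : Type*} [NormedAddCommGroup E] [NormedSpace ℝ E]
    [AddCommGroup F] [Module ℝ F] [TopologicalSpace F] [IsTopologicalAddGroup F]
    [ContinuousSMul ℝ F] [T2Space F] {f : E → F} {f' : E →L[ℝ] F} {x : E}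
    (h : HasFDerivAt f f' x) {γ : ℝ → E} {v : E} (hγ : HasDerivAt γ v 0) (h0 : γ 0 = x)
    (hc : ∀ t, f (γ t) = f x) : f' v = 0 := by
  have := h.tendsto_slope_curve hγ h0
  simp only [hc, sub_self, smul_zero] at this
  exact (tendsto_nhds_unique this tendsto_const_nhds)

/-- The increment `A y - A x` is big-O of `y - x`, so the remainder estimate pulls back along `A`;
no norm on `F` is involved. -/
theorem HasFDerivAt.comp_clm_tvs {E E' F : Type*} [NormedAddCommGroup E] [NormedSpace ℝ E]
    [NormedAddCommGroup E'] [NormedSpace ℝ E']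
    [AddCommGroup F] [Module ℝ F] [TopologicalSpace F] [IsTopologicalAddGroup F]
    [ContinuousSMul ℝ F] {f : E → F} {f' : E →L[ℝ] F} (A : E' →L[ℝ] E) {x : E'}
    (h : HasFDerivAt f f' (A x)) : HasFDerivAt (fun y => f (A y)) (f'.comp A) x := by
  rw [hasFDerivAt_iff_isLittleOTVS] at h ⊢
  have h1 := h.comp_tendsto (A.continuous.tendsto x)
  have h2 := h1.trans_isBigOTVS (k := fun y => y - x) (by
    simpa [Function.comp_def, ← map_sub] using A.isBigOTVS_fun_comp (f := fun y => y - x))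
  refine h2.congr_left fun y => ?_
  simp

/-! ### The action -/

section Action

variable {m d : ℕ} {p : ℝ}

theorem symAct_mul (g h : SymGroup m) (θ : Param m d) :
    symAct p (g * h) θ = symAct p g (symAct p h θ) :=
  (symMulAction m d p).mul_smul g h θ

theorem symAct_one (θ : Param m d) : symAct p 1 θ = θ :=
  (symMulAction m d p).one_smul θ

theorem symAct_inv_symAct (g : SymGroup m) (θ : Param m d) :
    symAct p g⁻¹ (symAct p g θ) = θ := by
  rw [← symAct_mul, inv_mul_cancel, symAct_one]

theorem symAct_symAct_inv (g : SymGroup m) (θ : Param m d) :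
    symAct p g (symAct p g⁻¹ θ) = θ := by
  rw [← symAct_mul, mul_inv_cancel, symAct_one]

/-- The action of a group element as a continuous linear map. -/
noncomputable def symActCLM (m d : ℕ) (p : ℝ) (g : SymGroup m) : Param m d →L[ℝ] Param m d :=
  LinearMap.toContinuousLinearMap
    { toFun := symAct p g
      map_add' := fun x y => by
        funext i
        simp [symAct, mul_add]
      map_smul' := fun c x => by
        funext i
        simp [symAct, smul_comm c, mul_left_comm] }

@[simp]
theorem symActCLM_apply (g : SymGroup m) (θ : Param m d) : symActCLM m d p g θ = symAct p g θ :=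
  rfl

theorem contDiff_symAct (g : SymGroup m) : ContDiff ℝ ∞ (symAct (d := d) p g) :=
  (symActCLM m d p g).contDiff

theorem continuous_symAct (g : SymGroup m) : Continuous (symAct (d := d) p g) :=
  (symActCLM m d p g).continuous

/-- The rescaling of one neuron. -/
noncomputable def neuronScale {d : ℕ} (p c : ℝ) (x : ℝ × EuclideanSpace ℝ (Fin d)) :
    ℝ × EuclideanSpace ℝ (Fin d) :=
  (c ^ (-p) * x.1, c • x.2)

theorem symAct_apply (g : SymGroup m) (θ : Param m d) (i : Fin m) :
    symAct p g θ i = neuronScale p (g.left i) (θ (g.right⁻¹ i)) := rfl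

theorem symAct_inl (c : Fin m → PosReal) (θ : Param m d) (i : Fin m) :
    symAct p (SemidirectProduct.inl c) θ i = neuronScale p (c i) (θ i) := by
  simp [symAct_apply]

theorem neuronScale_one (x : ℝ × EuclideanSpace ℝ (Fin d)) : neuronScale p 1 x = x := by
  simp [neuronScale]

theorem neuronScale_mul {c c' : ℝ} (hc : 0 < c) (hc' : 0 < c') (x : ℝ × EuclideanSpace ℝ (Fin d)) :
    neuronScale p (c * c') x = neuronScale p c (neuronScale p c' x) := by
  simp [neuronScale, Real.mul_rpow hc.le hc'.le, mul_assoc, smul_smul]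

theorem neuronScale_inv {c : ℝ} (hc : 0 < c) (x : ℝ × EuclideanSpace ℝ (Fin d)) :
    neuronScale p c⁻¹ (neuronScale p c x) = x := by
  rw [← neuronScale_mul (inv_pos.2 hc) hc, inv_mul_cancel₀ hc.ne', neuronScale_one]

theorem neuronScale_eq_zero {c : ℝ} (hc : 0 < c) {x : ℝ × EuclideanSpace ℝ (Fin d)} :
    neuronScale p c x = 0 ↔ x = 0 := by
  simp [neuronScale, Prod.ext_iff, hc.ne', (Real.rpow_pos_of_pos hc _).ne']

/-- When the inner weight vanishes, the factor is read off the outer weight, where `p ≠ 0` is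
essential. -/
theorem neuronScale_injective (hp : 0 < p) {c c' : ℝ} (hc : 0 < c) (hc' : 0 < c')
    {x : ℝ × EuclideanSpace ℝ (Fin d)} (hx : x ≠ 0)
    (h : neuronScale p c x = neuronScale p c' x) : c = c' := by
  simp only [neuronScale, Prod.ext_iff] at h
  by_cases h2 : x.2 = 0
  · have h1 : x.1 ≠ 0 := fun h1 => hx (Prod.ext h1 h2)
    exact (Real.rpow_left_inj hc.le hc'.le (neg_ne_zero.2 hp.ne')).1 (mul_right_cancel₀ h1 h.1)
  · exact smul_left_injective ℝ h2 h.2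

theorem symAct_ne_zero (g : SymGroup m) {θ : Param m d} (h : ∀ i, θ i ≠ 0) (i : Fin m) :
    symAct p g θ i ≠ 0 := by
  rw [symAct_apply, Ne, neuronScale_eq_zero (g.left i).2]
  exact h _

/-- A zero neuron is fixed by its own rescalings. These give a nonconstant continuous path in the
stabilizer, impossible in a discrete space. -/
theorem LocallyFreeAt.ne_zero {θ : Param m d} (h : LocallyFreeAt p θ) (i : Fin m) : θ i ≠ 0 := by
  intro hi
  let _ := symMulAction m d p
  let c : ℝ → Fin m → PosReal := fun t j => if j = i then ⟨Real.exp t, Real.exp_pos t⟩ else 1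
  have hc : Continuous c := by
    refine continuous_pi fun j => ?_
    by_cases hj : j = i
    · simpa [c, hj] using Real.continuous_exp.subtype_mk _
    · simp [c, hj, continuous_const]
  have hs : ∀ t, SemidirectProduct.inl (c t) ∈ MulAction.stabilizer (SymGroup m) θ := by
    intro t
    rw [MulAction.mem_stabilizer_iff]
    change symAct p _ θ = θ
    funext j
    rw [symAct_inl]
    by_cases hj : j = i
    · subst hj
      simp [hi, neuronScale]
    · simp [c, hj, neuronScale_one]
  let f : ℝ → MulAction.stabilizer (SymGroup m) θ := fun t => ⟨SemidirectProduct.inl (c t), hs t⟩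
  have hf : Continuous f := by
    refine Continuous.subtype_mk (continuous_induced_rng.2 ?_) _
    exact hc.prodMk (continuous_const (y := fun i => i))
  have hD : DiscreteTopology (MulAction.stabilizer (SymGroup m) θ) := h
  have hcst := PreconnectedSpace.constant inferInstance hf (x := 0) (y := 1)
  have h1 := SemidirectProduct.inl_injective (congrArg Subtype.val hcst)
  have h2 := congrArg Subtype.val (congrFun h1 i)
  have h3 : (1 : ℝ) = Real.exp 1 := by simpa [c] using h2
  exact (Real.one_lt_exp_iff.2 one_pos).ne h3

/-- On the stabilizer the permutation part is injective, since the factors are determined by nonzero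
neurons. It is also continuous into a discrete space. -/
theorem locallyFreeAt_of_ne_zero (hp : 0 < p) {θ : Param m d} (h : ∀ i, θ i ≠ 0) :
    LocallyFreeAt p θ := by
  let _ := symMulAction m d p
  have hc' : Continuous fun g : SymGroup m =>
    ((g.left, fun i => g.right i) : (Fin m → PosReal) × (Fin m → Fin m)) := continuous_induced_dom
  have hc : Continuous fun g : SymGroup m => (g.right : Fin m → Fin m) := hc'.snd
  refine DiscreteTopology.of_continuous_injective
    (f := fun g : MulAction.stabilizer (SymGroup m) θ => (g.1.right : Fin m → Fin m))
    (hc.comp continuous_subtype_val) ?_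
  rintro ⟨g, hg⟩ ⟨g', hg'⟩ hgg
  have hr : g.right = g'.right := DFunLike.coe_injective hgg
  refine Subtype.ext (SemidirectProduct.ext (funext fun i => Subtype.ext ?_) hr)
  have h1 : symAct p g θ i = symAct p g' θ i := by
    rw [MulAction.mem_stabilizer_iff] at hg hg'
    exact congrFun (hg.trans hg'.symm) i
  rw [symAct_apply, symAct_apply, hr] at h1
  exact neuronScale_injective hp (g.left i).2 (g'.left i).2 (h _) h1

theorem locallyFreeAt_iff (hp : 0 < p) {θ : Param m d} : LocallyFreeAt p θ ↔ ∀ i, θ i ≠ 0 :=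
  ⟨fun h => h.ne_zero, locallyFreeAt_of_ne_zero hp⟩

end Action

/-! ### The realization map -/

section Realization

variable {m d : ℕ} {p : ℝ} {σ : ℝ → ℝ} {F : Type*} [AddCommGroup F] [Module ℝ F]

/-- The image in `F` of the feature function with weight `w`. -/
noncomputable def featureImage (J : featureSpan d σ →ₗ[ℝ] F) (w : EuclideanSpace ℝ (Fin d)) : F :=
  J ⟨feature σ w, Submodule.subset_span ⟨w, rfl⟩⟩

theorem realization_eq_sum (J : featureSpan d σ →ₗ[ℝ] F) (θ : Param m d) :
    realization J m θ = ∑ i, (θ i).1 • featureImage J (θ i).2 := by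
  simp only [featureImage, ← map_smul, ← map_sum, realization]
  congr 1
  ext x
  simp [network, feature]

theorem featureImage_smul (hσ : PosHomogeneous p σ) (J : featureSpan d σ →ₗ[ℝ] F) {c : ℝ}
    (hc : 0 < c) (w : EuclideanSpace ℝ (Fin d)) :
    featureImage J (c • w) = c ^ p • featureImage J w := by
  simp only [featureImage, ← map_smul]
  congr 1
  ext x
  simp [feature, real_inner_smul_left, hσ _ _ hc]

/-- Homogeneity with factor `2` fixes the vector `0`, so the image is multiplied by `2 ^ p ≠ 1` and
stays the same. -/
theorem featureImage_zero (hp : 0 < p) (hσ : PosHomogeneous p σ) (J : featureSpan d σ →ₗ[ℝ] F) :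
    featureImage J 0 = 0 := by
  have h := featureImage_smul hσ J two_pos 0
  rw [smul_zero] at h
  have h2 : (1 - (2 : ℝ) ^ p) • featureImage J 0 = 0 := by
    rw [sub_smul, one_smul, ← h, sub_self]
  have h3 : (1 : ℝ) < 2 ^ p := Real.one_lt_rpow one_lt_two hp
  exact (smul_eq_zero.1 h2).resolve_left (by linarith)

theorem realization_symAct (hσ : PosHomogeneous p σ) (J : featureSpan d σ →ₗ[ℝ] F)
    (g : SymGroup m) (θ : Param m d) : realization J m (symAct p g θ) = realization J m θ := by
  simp only [realization_eq_sum, symAct]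
  rw [← Equiv.sum_comp g.right⁻¹ fun i => (θ i).1 • featureImage J (θ i).2]
  refine Finset.sum_congr rfl fun i _ => ?_
  have hc : (0 : ℝ) < g.left i := (g.left i).2
  rw [featureImage_smul hσ J hc, smul_smul, mul_right_comm, ← Real.rpow_add hc]
  simp

end Realization

/-! ### Slices for the rescaling of one neuron -/

/-- A slice for the rescaling action on an open set of neurons. -/
structure NeuronSlice (d : ℕ) (p : ℝ) where
  source : Set (ℝ × EuclideanSpace ℝ (Fin d))
  isOpen_source : IsOpen source
  proj : ℝ × EuclideanSpace ℝ (Fin d) → EuclideanSpace ℝ (Fin d)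
  contDiffOn_proj : ContDiffOn ℝ ∞ proj source
  sect : EuclideanSpace ℝ (Fin d) → ℝ × EuclideanSpace ℝ (Fin d)
  contDiff_sect : ContDiff ℝ ∞ sect
  sect_mem : ∀ b, sect b ∈ source
  proj_sect : ∀ b, proj (sect b) = b
  scale_mem : ∀ c, 0 < c → ∀ x ∈ source, neuronScale p c x ∈ source
  proj_scale : ∀ c, 0 < c → ∀ x ∈ source, proj (neuronScale p c x) = proj x
  exists_scale : ∀ x ∈ source, ∃ c, 0 < c ∧ neuronScale p c x = sect (proj x)

/-- The slice that normalizes the outer weight to `ε = ±1`. -/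
noncomputable def outerSlice (d : ℕ) {p : ℝ} (hp : 0 < p) (ε : ℝ) (hε : ε * ε = 1) :
    NeuronSlice d p where
  source := {y | 0 < ε * y.1}
  isOpen_source := isOpen_lt continuous_const (by fun_prop)
  -- The factor `c = (ε a) ^ (1/p)` gives `c ^ (-p) a = ε`; the coordinate is the inner weight after
  -- this rescaling.
  proj y := (ε * y.1) ^ p⁻¹ • y.2
  contDiffOn_proj := by
    refine ContDiffOn.smul (ContDiffOn.rpow_const_of_ne (by fun_prop) fun y hy => ?_) (by fun_prop)
    exact (show 0 < ε * y.1 from hy).ne'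
  sect b := (ε, b)
  contDiff_sect := by fun_prop
  sect_mem b := by simp [hε]
  proj_sect b := by simp [hε]
  scale_mem c hc x hx := by
    have h := mul_pos (Real.rpow_pos_of_pos hc (-p)) (show 0 < ε * x.1 from hx)
    simpa [neuronScale, mul_left_comm] using h
  proj_scale c hc x hx := by
    have hx : 0 < ε * x.1 := hx
    have hcp := Real.rpow_pos_of_pos hc (-p)
    simp only [neuronScale]
    rw [mul_left_comm, Real.mul_rpow hcp.le hx.le, ← Real.rpow_mul hc.le, neg_mul,
      mul_inv_cancel₀ hp.ne', Real.rpow_neg_one, smul_smul, mul_right_comm, inv_mul_cancel₀ hc.ne',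
      one_mul]
  exists_scale x hx := by
    have hx : 0 < ε * x.1 := hx
    refine ⟨(ε * x.1) ^ p⁻¹, Real.rpow_pos_of_pos hx _, Prod.ext ?_ rfl⟩
    simp only [neuronScale]
    rw [← Real.rpow_mul hx.le, mul_neg, inv_mul_cancel₀ hp.ne', Real.rpow_neg_one,
      inv_mul_eq_iff_eq_mul₀ hx.ne']
    linear_combination -x.1 * hε

/-- The slice that normalizes the `k`-th inner weight to `ε = ±1`. -/
noncomputable def innerSlice {d : ℕ} (p : ℝ) (k : Fin d) (ε : ℝ) (hε : ε * ε = 1) :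
    NeuronSlice d p where
  source := {y | 0 < ε * y.2 k}
  isOpen_source := isOpen_lt continuous_const (by fun_prop)
  -- Normalizing frees the `k`-th slot, which stores the rescaled outer weight, so the coordinates
  -- still fill a `d`-dimensional space.
  proj y := WithLp.toLp 2 fun j =>
    if j = k then (ε * y.2 k)⁻¹ ^ (-p) * y.1 else (ε * y.2 k)⁻¹ * y.2 j
  contDiffOn_proj := by
    have h1 : ContDiffOn ℝ ∞ (fun y : ℝ × EuclideanSpace ℝ (Fin d) => (ε * y.2 k)⁻¹)
        {y | 0 < ε * y.2 k} :=
      ContDiffOn.inv (by fun_prop) fun y hy => (show 0 < ε * y.2 k from hy).ne'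
    refine (contDiffOn_euclidean).2 fun j => ?_
    by_cases hj : j = k
    · simp only [hj, if_true]
      refine (h1.rpow_const_of_ne fun y hy => ?_).mul (by fun_prop)
      exact inv_ne_zero (show 0 < ε * y.2 k from hy).ne'
    · simp only [hj, if_false]
      exact h1.mul (by fun_prop)
  sect b := (b k, WithLp.toLp 2 fun j => if j = k then ε else b j)
  contDiff_sect := by
    refine ContDiff.prodMk (by fun_prop) (contDiff_euclidean.2 fun j => ?_)
    by_cases hj : j = k
    · simp only [hj, if_true]; fun_prop
    · simp only [hj, if_false]; fun_prop
  sect_mem b := by simp [hε]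
  proj_sect b := by
    ext j
    by_cases hj : j = k <;> simp [hε, hj]
  scale_mem c hc x hx := by
    have h := mul_pos hc (show 0 < ε * x.2 k from hx)
    simpa [neuronScale, mul_left_comm] using h
  proj_scale c hc x hx := by
    have hx : 0 < ε * x.2 k := hx
    ext j
    have hcp := Real.rpow_pos_of_pos hc (-p)
    by_cases hj : j = k
    · simp only [neuronScale, hj, if_true, PiLp.smul_apply, smul_eq_mul]
      rw [mul_left_comm ε, mul_inv, Real.mul_rpow (inv_nonneg.2 hc.le) (inv_nonneg.2 hx.le),
        Real.inv_rpow hc.le]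
      field_simp
    · simp only [neuronScale, hj, if_false, PiLp.smul_apply, smul_eq_mul]
      field_simp
  exists_scale x hx := by
    have hx : 0 < ε * x.2 k := hx
    refine ⟨(ε * x.2 k)⁻¹, inv_pos.2 hx, Prod.ext (by simp [neuronScale]) ?_⟩
    ext j
    by_cases hj : j = k
    · simp only [neuronScale, hj, if_true, PiLp.smul_apply, smul_eq_mul]
      rw [inv_mul_eq_iff_eq_mul₀ hx.ne']
      linear_combination -x.2 k * hε
    · simp [neuronScale, hj]

theorem exists_mul_self_eq_one_of_ne_zero {x : ℝ} (hx : x ≠ 0) :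
    ∃ ε : ℝ, ε * ε = 1 ∧ 0 < ε * x := by
  rcases hx.lt_or_gt with h | h
  · exact ⟨-1, by norm_num, by linarith⟩
  · exact ⟨1, by norm_num, by linarith⟩

theorem exists_neuronSlice {d : ℕ} {p : ℝ} (hp : 0 < p) {x : ℝ × EuclideanSpace ℝ (Fin d)}
    (hx : x ≠ 0) : ∃ S : NeuronSlice d p, x ∈ S.source := by
  by_cases h1 : x.1 = 0
  · have h2 : x.2 ≠ 0 := fun h2 => hx (Prod.ext h1 h2)
    obtain ⟨k, hk⟩ : ∃ k, x.2 k ≠ 0 := by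
      by_contra! h
      exact h2 (PiLp.ext h)
    obtain ⟨ε, hε, h⟩ := exists_mul_self_eq_one_of_ne_zero hk
    exact ⟨innerSlice p k ε hε, h⟩
  · obtain ⟨ε, hε, h⟩ := exists_mul_self_eq_one_of_ne_zero h1
    exact ⟨outerSlice d hp ε hε, h⟩

theorem NeuronSlice.exists_scale_eq {d : ℕ} {p : ℝ} (S : NeuronSlice d p)
    {x y : ℝ × EuclideanSpace ℝ (Fin d)} (hx : x ∈ S.source) (hy : y ∈ S.source)
    (h : S.proj x = S.proj y) : ∃ c, 0 < c ∧ neuronScale p c x = y := by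
  obtain ⟨c, hc, hcx⟩ := S.exists_scale x hx
  obtain ⟨c', hc', hcy⟩ := S.exists_scale y hy
  refine ⟨c'⁻¹ * c, by positivity, ?_⟩
  rw [neuronScale_mul (inv_pos.2 hc') hc, hcx, h, ← hcy, neuronScale_inv hc']

/-! ### The tangent space of an orbit -/

section Tangent

variable {m d : ℕ} {p : ℝ}

/-- The curve `t ↦ exp(t ξ) · θ`. -/
noncomputable def scalingCurve (p : ℝ) (θ : Param m d) (ξ : Fin m → ℝ) (t : ℝ) : Param m d :=
  fun i => (Real.exp (-p * ξ i * t) * (θ i).1, Real.exp (ξ i * t) • (θ i).2)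

theorem scalingCurve_eq_symAct (θ : Param m d) (ξ : Fin m → ℝ) (t : ℝ) :
    scalingCurve p θ ξ t =
      symAct p (SemidirectProduct.inl fun i => ⟨Real.exp (ξ i * t), Real.exp_pos _⟩) θ := by
  funext i
  rw [symAct_inl]
  simp only [scalingCurve, neuronScale, ← Real.exp_mul]
  congr 3
  ring

theorem scalingCurve_zero (θ : Param m d) (ξ : Fin m → ℝ) : scalingCurve p θ ξ 0 = θ := by
  funext i
  simp [scalingCurve]

theorem contDiff_scalingCurve (θ : Param m d) (ξ : Fin m → ℝ) :
    ContDiff ℝ ∞ (scalingCurve p θ ξ) := by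
  unfold scalingCurve
  fun_prop

theorem hasDerivAt_scalingCurve (θ : Param m d) (ξ : Fin m → ℝ) :
    HasDerivAt (scalingCurve p θ ξ) (scalingDirection p θ ξ) 0 := by
  refine hasDerivAt_pi.2 fun i => ?_
  have h1 (a : ℝ) : HasDerivAt (fun t : ℝ => Real.exp (a * t)) a 0 := by
    simpa using ((hasDerivAt_id (0 : ℝ)).const_mul a).exp
  exact ((h1 (-p * ξ i)).mul_const _).prodMk ((h1 (ξ i)).smul_const _)

theorem scalingDirection_mem_orbitTangent (θ : Param m d) (ξ : Fin m → ℝ) :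
    scalingDirection p θ ξ ∈ orbitTangent p θ :=
  ⟨scalingCurve p θ ξ, contDiff_scalingCurve θ ξ,
    fun t => ⟨_, (scalingCurve_eq_symAct θ ξ t).symm⟩, scalingCurve_zero θ ξ,
    hasDerivAt_scalingCurve θ ξ⟩

/-- The slice coordinate is scale invariant, so along the curve it takes values among the finitely
many coordinates of the neurons of `θ`. Being continuous at `0`, it is locally constant there. -/
theorem eventually_scale_of_curve_mem_orbit (hp : 0 < p) {θ : Param m d} {i : Fin m}
    (hi : θ i ≠ 0) {γ : ℝ → Param m d} (hγ : Continuous γ) (h0 : γ 0 = θ)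
    (hmem : ∀ t, γ t ∈ symOrbit p θ) :
    ∀ᶠ t in 𝓝 (0 : ℝ), ∃ c, 0 < c ∧ neuronScale p c (θ i) = γ t i := by
  obtain ⟨S, hS⟩ := exists_neuronSlice hp hi
  have hγi : Continuous fun t => γ t i := (continuous_apply i).comp hγ
  have h0i : γ 0 i = θ i := by rw [h0]
  have h1 : ∀ᶠ t in 𝓝 (0 : ℝ), γ t i ∈ S.source :=
    hγi.continuousAt.eventually_mem (S.isOpen_source.mem_nhds (by rwa [h0i]))
  have h2 : ContinuousAt (fun t => S.proj (γ t i)) 0 := by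
    refine ContinuousAt.comp (g := S.proj) ?_ hγi.continuousAt
    exact S.contDiffOn_proj.continuousOn.continuousAt (S.isOpen_source.mem_nhds (by rwa [h0i]))
  -- The values to be avoided: a finite, hence closed, set that omits the initial value.
  let A : Set (EuclideanSpace ℝ (Fin d)) := range (fun j => S.proj (θ j)) \ {S.proj (θ i)}
  have hA : Aᶜ ∈ 𝓝 (S.proj (γ 0 i)) := by
    refine ((finite_range _).sdiff).isClosed.isOpen_compl.mem_nhds ?_
    simp [h0i]
  filter_upwards [h1, h2.eventually_mem hA] with t ht1 ht2
  refine S.exists_scale_eq hS ht1 ?_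
  obtain ⟨g, hg⟩ := hmem t
  have hg' : neuronScale p (g.left i) (θ (g.right⁻¹ i)) = γ t i := congrFun hg i
  have hj : θ (g.right⁻¹ i) ∈ S.source := by
    rw [← neuronScale_inv (p := p) (g.left i).2 (θ (g.right⁻¹ i)), hg']
    exact S.scale_mem _ (inv_pos.2 (g.left i).2) _ ht1
  have h3 : S.proj (γ t i) = S.proj (θ (g.right⁻¹ i)) := by
    rw [← hg', S.proj_scale _ (g.left i).2 _ hj]
  by_contra hne
  exact ht2 ⟨⟨_, h3.symm⟩, fun h => hne (mem_singleton_iff.1 h).symm⟩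

/-- The factors are not assumed differentiable in `t`. If `x.2 ≠ 0` they are recovered from the
inner weight by an inner product, and `ξ` is their derivative. If `x.2 = 0` the inner weight stays
zero, and any outer velocity comes from a scaling. -/
theorem exists_eq_of_hasDerivAt_scale {x v : ℝ × EuclideanSpace ℝ (Fin d)}
    {γ : ℝ → ℝ × EuclideanSpace ℝ (Fin d)} (hp : 0 < p) (hx : x ≠ 0) (h0 : γ 0 = x)
    (hγ : HasDerivAt γ v 0)
    (h : ∀ᶠ t in 𝓝 (0 : ℝ), ∃ c, 0 < c ∧ neuronScale p c x = γ t) :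
    ∃ ξ : ℝ, v = (-p * ξ * x.1, ξ • x.2) := by
  have hv1 : HasDerivAt (fun t => (γ t).1) v.1 0 :=
    (ContinuousLinearMap.fst ℝ ℝ (EuclideanSpace ℝ (Fin d))).hasFDerivAt.comp_hasDerivAt _ hγ
  have hv2 : HasDerivAt (fun t => (γ t).2) v.2 0 :=
    (ContinuousLinearMap.snd ℝ ℝ (EuclideanSpace ℝ (Fin d))).hasFDerivAt.comp_hasDerivAt _ hγ
  by_cases h2 : x.2 = 0
  · have h1 : x.1 ≠ 0 := fun h1 => hx (Prod.ext h1 h2)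
    have h3 : v.2 = 0 := by
      refine hv2.unique (HasDerivAt.congr_of_eventuallyEq (hasDerivAt_const _ 0) ?_)
      filter_upwards [h] with t ⟨c, _, hc⟩
      simp [← hc, neuronScale, h2]
    refine ⟨-v.1 / (p * x.1), Prod.ext ?_ (by simp [h2, h3])⟩
    field_simp
  · let c : ℝ → ℝ := fun t => inner ℝ x.2 (γ t).2 / inner ℝ x.2 x.2
    have hx2 : inner ℝ x.2 x.2 ≠ 0 := inner_self_ne_zero.2 h2
    have hc : HasDerivAt c (inner ℝ x.2 v.2 / inner ℝ x.2 x.2) 0 :=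
      ((innerSL ℝ x.2).hasFDerivAt.comp_hasDerivAt _ hv2).div_const _
    have hc0 : c 0 = 1 := by simp only [c, h0]; exact div_self hx2
    have hev : ∀ᶠ t in 𝓝 (0 : ℝ), neuronScale p (c t) x = γ t := by
      filter_upwards [h] with t ⟨a, _, ha⟩
      have : c t = a := by
        simp only [c, ← ha, neuronScale, inner_smul_right]
        field_simp
      rw [this, ha]
    refine ⟨inner ℝ x.2 v.2 / inner ℝ x.2 x.2, Prod.ext ?_ ?_⟩
    · refine hv1.unique (HasDerivAt.congr_of_eventuallyEq (f := fun t => c t ^ (-p) * x.1) ?_ ?_)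
      · have := (hc.rpow_const (p := -p) (Or.inl (by rw [hc0]; exact one_ne_zero))).mul_const x.1
        exact this.congr_deriv (by rw [hc0, Real.one_rpow]; ring)
      · filter_upwards [hev] with t ht
        simp [← ht, neuronScale]
    · refine hv2.unique (HasDerivAt.congr_of_eventuallyEq (hc.smul_const x.2) ?_)
      filter_upwards [hev] with t ht
      simp [← ht, neuronScale]

theorem orbitTangent_eq_range (hp : 0 < p) {θ : Param m d} (h : ∀ i, θ i ≠ 0) :
    orbitTangent p θ = range (scalingDirection p θ) := by
  refine Subset.antisymm ?_ (range_subset_iff.2 (scalingDirection_mem_orbitTangent θ))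
  rintro v ⟨γ, hγ, hmem, h0, hv⟩
  choose ξ hξ using fun i => exists_eq_of_hasDerivAt_scale hp (h i) (congrFun h0 i)
    (hasDerivAt_pi.1 hv i) (eventually_scale_of_curve_mem_orbit hp (h i) hγ.continuous h0 hmem)
  exact ⟨ξ, (funext hξ).symm⟩

end Tangent

/-! ### The regular set -/

section ScalingMap

variable {m d : ℕ} {p : ℝ}

/-- The infinitesimal action `ξ ↦ δ_ξ θ` as a linear map. -/
noncomputable def scalingMap (p : ℝ) (θ : Param m d) : (Fin m → ℝ) →ₗ[ℝ] Param m d where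
  toFun := scalingDirection p θ
  map_add' ξ η := by
    funext i
    simp [scalingDirection, mul_add, add_mul, add_smul]
  map_smul' c ξ := by
    funext i
    simp [scalingDirection, mul_assoc, mul_smul, mul_left_comm]

theorem scalingMap_injective (hp : 0 < p) {θ : Param m d} (h : ∀ i, θ i ≠ 0) :
    Function.Injective (scalingMap p θ) := by
  rw [← LinearMap.ker_eq_bot, LinearMap.ker_eq_bot']
  intro ξ hξ
  funext i
  have hi : (-p * ξ i * (θ i).1, ξ i • (θ i).2) = (0 : ℝ × EuclideanSpace ℝ (Fin d)) :=
    congrFun hξ i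
  simp only [Prod.mk_eq_zero, mul_eq_zero, neg_eq_zero, hp.ne', false_or, smul_eq_zero] at hi
  by_contra hne
  exact h i (Prod.ext (hi.1.resolve_left hne) (hi.2.resolve_left hne))

theorem finrank_range_scalingMap (hp : 0 < p) {θ : Param m d} (h : ∀ i, θ i ≠ 0) :
    Module.finrank ℝ (LinearMap.range (scalingMap p θ)) = m := by
  simp [LinearMap.finrank_range_of_inj (scalingMap_injective hp h)]

theorem symAct_scalingDirection (g : SymGroup m) (θ : Param m d) (ξ : Fin m → ℝ) :
    symAct p g (scalingDirection p θ ξ) =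
      scalingDirection p (symAct p g θ) (fun i => ξ (g.right⁻¹ i)) := by
  funext i
  refine Prod.ext ?_ ?_
  · simp only [symAct, scalingDirection]
    ring
  · simp only [symAct, scalingDirection]
    rw [smul_comm]

end ScalingMap

/-! ### Semicontinuity of the kernel dimension, and a limit that determines the exponent -/

/-- On a complement `C` of the kernel at `x₀`, the map `D x₀` has no zero on the compact unit
sphere. The same holds for nearby `x`, so `ker (D x)` meets `C` only in zero. -/
theorem eventually_finrank_ker_le {X E F : Type*} [TopologicalSpace X] [NormedAddCommGroup E]
    [NormedSpace ℝ E] [FiniteDimensional ℝ E] [AddCommGroup F] [Module ℝ F] [TopologicalSpace F]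
    [IsTopologicalAddGroup F] [ContinuousSMul ℝ F] [T2Space F] {D : X → E →L[ℝ] F} {x₀ : X}
    (hD : ∀ v, ContinuousAt (fun x => D x v) x₀) :
    ∀ᶠ x in 𝓝 x₀, Module.finrank ℝ (LinearMap.ker (D x).toLinearMap) ≤
      Module.finrank ℝ (LinearMap.ker (D x₀).toLinearMap) := by
  obtain ⟨C, hC⟩ := Submodule.exists_isCompl (LinearMap.ker (D x₀).toLinearMap)
  let b := Module.finBasis ℝ E
  -- Continuity is given for each fixed vector only; expanding in a finite basis makes it joint.
  have hjoint (v : E) : ContinuousAt (fun z : X × E => D z.1 z.2) (x₀, v) := by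
    have h1 : (fun z : X × E => D z.1 z.2) = fun z => ∑ i, b.equivFun z.2 i • D z.1 (b i) := by
      funext z
      have h2 := congrArg (D z.1) (b.sum_equivFun z.2)
      rw [map_sum] at h2
      simpa only [map_smul] using h2.symm
    rw [h1]
    refine tendsto_finsetSum _ fun i _ => Tendsto.smul ?_ ?_
    · have : Continuous fun z : X × E => b.equivFun z.2 i :=
        (continuous_apply i).comp
          ((LinearMap.continuous_of_finiteDimensional b.equivFun.toLinearMap).comp continuous_snd)
      exact this.continuousAt
    · exact ContinuousAt.comp (f := Prod.fst) (x := (x₀, v)) (hD (b i)) continuousAt_fst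
  have hcomp : IsCompact ((C : Set E) ∩ Metric.sphere 0 1) :=
    (isCompact_sphere 0 1).inter_left C.closed_of_finiteDimensional
  have hne : ∀ v ∈ (C : Set E) ∩ Metric.sphere 0 1, ∀ᶠ z : X × E in 𝓝 (x₀, v),
      D z.1 z.2 ≠ 0 := by
    rintro v ⟨hvC, hv1⟩
    refine (hjoint v).eventually_ne fun h0 => ?_
    have : v = 0 := (Submodule.disjoint_def.1 hC.disjoint) v h0 hvC
    simp [this] at hv1
  filter_upwards [hcomp.eventually_forall_of_forall_eventually
    (P := fun x v => D x v ≠ 0) hne] with x hx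
  have hdisj : Disjoint (LinearMap.ker (D x).toLinearMap) C := by
    rw [Submodule.disjoint_def]
    intro v hv hvC
    by_contra hv0
    refine hx (‖v‖⁻¹ • v) ⟨C.smul_mem _ hvC, by simp [norm_smul, hv0]⟩ ?_
    have hv' : D x v = 0 := hv
    simp [hv']
  have h1 := Submodule.finrank_add_finrank_le_of_disjoint hdisj
  have h2 := Submodule.finrank_add_eq_of_isCompl hC
  omega

/-- Replacing `t` by `2 t` multiplies the expression by `2 ^ (p - 1)` without changing the limit `y
≠ 0`. -/
theorem one_eq_of_tendsto_rpow_smul {F : Type*} [AddCommGroup F] [Module ℝ F]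
    [TopologicalSpace F] [ContinuousSMul ℝ F] [T2Space F] {p : ℝ} {x y : F} (hy : y ≠ 0)
    (h : Tendsto (fun t : ℝ => (t⁻¹ * t ^ p) • x) (𝓝[>] 0) (𝓝 y)) : p = 1 := by
  have h2 : Tendsto (fun t : ℝ => 2 * t) (𝓝[>] 0) (𝓝[>] 0) := by
    refine tendsto_nhdsWithin_iff.2 ⟨?_, ?_⟩
    · refine Tendsto.mono_left ?_ nhdsWithin_le_nhds
      exact (continuous_const.mul continuous_id).tendsto' _ _ (by simp)
    · filter_upwards [self_mem_nhdsWithin] with t ht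
      exact mul_pos two_pos (show 0 < t from ht)
  have h3 : Tendsto (fun t : ℝ => (t⁻¹ * t ^ p) • x) (𝓝[>] 0) (𝓝 ((2 * 2 ^ (-p) : ℝ) • y)) := by
    refine ((h.comp h2).const_smul (2 * 2 ^ (-p) : ℝ)).congr' ?_
    filter_upwards [self_mem_nhdsWithin] with t ht
    have ht : 0 < t := ht
    simp only [Function.comp_apply, smul_smul]
    rw [Real.mul_rpow two_pos.le ht.le, Real.rpow_neg two_pos.le]
    have : (0 : ℝ) < 2 ^ p := Real.rpow_pos_of_pos two_pos p
    congr 1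
    field_simp
  have h4 : (2 * 2 ^ (-p) - 1 : ℝ) • y = 0 := by
    rw [sub_smul, one_smul, tendsto_nhds_unique h3 h, sub_self]
  have h5 : (2 : ℝ) ^ p = 2 ^ (1 : ℝ) := by
    have h6 := (smul_eq_zero.1 h4).resolve_right hy
    have : (0 : ℝ) < 2 ^ p := Real.rpow_pos_of_pos two_pos p
    rw [Real.rpow_neg two_pos.le] at h6
    rw [Real.rpow_one]
    field_simp at h6
    linarith
  exact (Real.rpow_right_inj two_pos (by norm_num)).1 h5

/-! ### Invariance and openness of the regular set, and distinct directions at regular points -/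

section Regular

variable {m d : ℕ} {p : ℝ} {σ : ℝ → ℝ} {F : Type*} [AddCommGroup F] [Module ℝ F]

theorem realization_eq_of_pair (J : featureSpan d σ →ₗ[ℝ] F) {θ η : Param m d} {i j : Fin m}
    (hij : i ≠ j) (h : ∀ k, k ≠ i → k ≠ j → η k = θ k)
    (hsum : (η i).1 • featureImage J (η i).2 + (η j).1 • featureImage J (η j).2 =
      (θ i).1 • featureImage J (θ i).2 + (θ j).1 • featureImage J (θ j).2) :
    realization J m η = realization J m θ := by
  rw [realization_eq_sum, realization_eq_sum, ← Finset.sum_add_sum_compl {i, j},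
    ← Finset.sum_add_sum_compl {i, j} fun k => (θ k).1 • featureImage J (θ k).2,
    Finset.sum_pair hij, Finset.sum_pair hij, hsum]
  congr 1
  refine Finset.sum_congr rfl fun k hk => ?_
  simp only [Finset.mem_compl, Finset.mem_insert, Finset.mem_singleton, not_or] at hk
  rw [h k hk.1 hk.2]

variable [TopologicalSpace F]

theorem mem_regularSet_iff (hp : 0 < p) {J : featureSpan d σ →ₗ[ℝ] F} {θ : Param m d} :
    θ ∈ regularSet p J m ↔ DifferentiableAt ℝ (realization J m) θ ∧
      {v | fderiv ℝ (realization J m) θ v = 0} = range (scalingDirection p θ) ∧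
      ∀ i, θ i ≠ 0 := by
  constructor
  · rintro ⟨h1, h2, h3⟩
    have h3' := (locallyFreeAt_iff hp).1 h3
    exact ⟨h1, h2.trans (orbitTangent_eq_range hp h3'), h3'⟩
  · rintro ⟨h1, h2, h3⟩
    exact ⟨h1, h2.trans (orbitTangent_eq_range hp h3).symm, locallyFreeAt_of_ne_zero hp h3⟩

variable [IsTopologicalAddGroup F] [ContinuousSMul ℝ F] [T2Space F]

theorem fderiv_realization_scalingDirection (hσ : PosHomogeneous p σ)
    {J : featureSpan d σ →ₗ[ℝ] F} {θ : Param m d}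
    (h : DifferentiableAt ℝ (realization J m) θ) (ξ : Fin m → ℝ) :
    fderiv ℝ (realization J m) θ (scalingDirection p θ ξ) = 0 :=
  h.hasFDerivAt.apply_eq_zero_of_curve (hasDerivAt_scalingCurve θ ξ) (scalingCurve_zero θ ξ)
    fun t => by rw [scalingCurve_eq_symAct, realization_symAct hσ]

/-- Invariance gives `Φ = Φ ∘ g⁻¹`, so the derivative at `g · θ` is `DΦ_θ ∘ g⁻¹`, and `g` maps
scaling directions to scaling directions. -/
theorem symAct_mem_regularSet (hp : 0 < p) (hσ : PosHomogeneous p σ)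
    (J : featureSpan d σ →ₗ[ℝ] F) (g : SymGroup m) {θ : Param m d}
    (h : θ ∈ regularSet p J m) : symAct p g θ ∈ regularSet p J m := by
  rw [mem_regularSet_iff hp] at h ⊢
  obtain ⟨h1, h2, h3⟩ := h
  have h4 : HasFDerivAt (realization J m)
      ((fderiv ℝ (realization J m) θ).comp (symActCLM m d p g⁻¹)) (symAct p g θ) := by
    have h5 : HasFDerivAt (realization J m) (fderiv ℝ (realization J m) θ)
        (symActCLM m d p g⁻¹ (symAct p g θ)) := by
      rw [symActCLM_apply, symAct_inv_symAct]
      exact h1.hasFDerivAt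
    simpa only [symActCLM_apply, realization_symAct hσ] using
      HasFDerivAt.comp_clm_tvs (symActCLM m d p g⁻¹) h5
  refine ⟨h4.differentiableAt, ?_, symAct_ne_zero g h3⟩
  rw [h4.fderiv]
  ext v
  have h6 : symAct p g⁻¹ v ∈ {v | fderiv ℝ (realization J m) θ v = 0} ↔
    symAct p g⁻¹ v ∈ range (scalingDirection p θ) := by rw [h2]
  refine h6.trans ⟨?_, ?_⟩
  · rintro ⟨ξ, hξ⟩
    exact ⟨_, by rw [← symAct_scalingDirection, hξ, symAct_symAct_inv]⟩
  · rintro ⟨ξ, rfl⟩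
    rw [symAct_scalingDirection, symAct_inv_symAct]
    exact ⟨_, rfl⟩

/-- Near a regular point the kernel has dimension at most `m`, yet it contains the `m`-dimensional
space of scaling directions; hence equality. -/
theorem isOpen_regularSet (hp : 0 < p) (hσ : PosHomogeneous p σ) (J : featureSpan d σ →ₗ[ℝ] F)
    {U : Set (Param m d)} (hU : IsOpen U) (hsub : regularSet p J m ⊆ U)
    (hC : ContinuouslyDifferentiableOn (realization J m) U) : IsOpen (regularSet p J m) := by
  rw [isOpen_iff_mem_nhds]
  intro θ₀ hθ₀
  have hU₀ := hU.mem_nhds (hsub hθ₀)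
  obtain ⟨h1, h2, h3⟩ := (mem_regularSet_iff hp).1 hθ₀
  have hne : ∀ᶠ θ : Param m d in 𝓝 θ₀, ∀ i, θ i ≠ 0 :=
    eventually_all.2 fun i => (continuous_apply i).continuousAt.eventually_ne (h3 i)
  filter_upwards [hU₀, hne,
    eventually_finrank_ker_le fun v => (hC.2 v).continuousAt hU₀] with θ hθU hθ hfin
  refine (mem_regularSet_iff hp).2 ⟨hC.1 θ hθU, ?_, hθ⟩
  have hk₀ : LinearMap.ker (fderiv ℝ (realization J m) θ₀).toLinearMap =
      LinearMap.range (scalingMap p θ₀) := SetLike.coe_injective h2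
  rw [hk₀, finrank_range_scalingMap hp h3] at hfin
  have hle : LinearMap.range (scalingMap p θ) ≤
      LinearMap.ker (fderiv ℝ (realization J m) θ).toLinearMap := by
    rintro _ ⟨ξ, rfl⟩
    exact fderiv_realization_scalingDirection hσ (hC.1 θ hθU) ξ
  exact congrArg SetLike.coe (Submodule.eq_of_le_of_finrank_le hle
    (hfin.trans_eq (finrank_range_scalingMap hp hθ).symm)).symm

/-- The tool for contradictions: a linear motion of two neurons that preserves their joint
contribution has velocity in `ker DΦ`, which at a regular point consists of scalings. -/
theorem exists_scaling_of_pair (hp : 0 < p) {J : featureSpan d σ →ₗ[ℝ] F} {θ : Param m d}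
    (hθ : θ ∈ regularSet p J m) {i j : Fin m} (hij : i ≠ j) (x y : ℝ × EuclideanSpace ℝ (Fin d))
    (hsum : ∀ t : ℝ, ((θ i).1 + t * x.1) • featureImage J ((θ i).2 + t • x.2) +
        ((θ j).1 + t * y.1) • featureImage J ((θ j).2 + t • y.2) =
      (θ i).1 • featureImage J (θ i).2 + (θ j).1 • featureImage J (θ j).2) :
    ∃ ξ : ℝ, x = (-p * ξ * (θ i).1, ξ • (θ i).2) := by
  obtain ⟨h1, h2, h3⟩ := (mem_regularSet_iff hp).1 hθ
  let v : Param m d := fun k => if k = i then x else if k = j then y else 0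
  have hv : HasDerivAt (fun t : ℝ => θ + t • v) v 0 := by
    simpa using ((hasDerivAt_id (0 : ℝ)).smul_const v).const_add θ
  have h0 : fderiv ℝ (realization J m) θ v = 0 := by
    refine h1.hasFDerivAt.apply_eq_zero_of_curve hv (by simp) fun t => ?_
    refine realization_eq_of_pair J hij (fun k hki hkj => by simp [v, hki, hkj]) ?_
    simpa [v, hij.symm] using hsum t
  have h4 : v ∈ range (scalingDirection p θ) := by
    rw [← h2]
    exact h0
  obtain ⟨ξ, hξ⟩ := h4
  refine ⟨ξ i, ?_⟩
  have := congrFun hξ i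
  simp only [v, if_true] at this
  exact this.symm

/-- Varying the zero inner weight along `u` yields difference quotients `aᵢ t⁻¹ t ^ p • featureImage
J u`, whose limit is linear in `u`. No scaling moves a zero weight, so the limit is nonzero for `u ≠
0`. This forces `p = 1`, and then `featureImage` is the limit itself. -/
theorem featureImage_linear_of_inner_eq_zero (hp : 0 < p) (hd : 0 < d) (hσ : PosHomogeneous p σ)
    {J : featureSpan d σ →ₗ[ℝ] F} {θ : Param m d} (hθ : θ ∈ regularSet p J m) {i : Fin m}
    (hi : (θ i).2 = 0) : ∃ T : EuclideanSpace ℝ (Fin d) →ₗ[ℝ] F, ∀ u, featureImage J u = T u := by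
  obtain ⟨h1, h2, h3⟩ := (mem_regularSet_iff hp).1 hθ
  have ha : (θ i).1 ≠ 0 := fun h => h3 i (Prod.ext h hi)
  let A : EuclideanSpace ℝ (Fin d) →ₗ[ℝ] Param m d :=
    LinearMap.single ℝ (fun _ : Fin m => ℝ × EuclideanSpace ℝ (Fin d)) i ∘ₗ LinearMap.inr ℝ ℝ _
  let T : EuclideanSpace ℝ (Fin d) →ₗ[ℝ] F :=
    (θ i).1⁻¹ • ((fderiv ℝ (realization J m) θ).toLinearMap ∘ₗ A)
  have hA (u) (k) : A u k = if k = i then (0, u) else 0 := by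
    by_cases hk : k = i
    · subst hk; simp [A]
    · simp [A, hk]
  have hlim (u) : Tendsto (fun t : ℝ => (t⁻¹ * t ^ p) • featureImage J u) (𝓝[>] 0) (𝓝 (T u)) := by
    have hv : HasDerivAt (fun t : ℝ => θ + t • A u) (A u) 0 := by
      simpa using ((hasDerivAt_id (0 : ℝ)).smul_const (A u)).const_add θ
    have h4 := (h1.hasFDerivAt.tendsto_slope_curve hv (by simp)).mono_left
      (nhdsWithin_mono (0 : ℝ) fun t (ht : 0 < t) => ht.ne')
    refine (h4.const_smul (θ i).1⁻¹).congr' ?_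
    filter_upwards [self_mem_nhdsWithin] with t ht
    have h5 : realization J m (θ + t • A u) - realization J m θ =
        (θ i).1 • featureImage J (t • u) := by
      rw [realization_eq_sum, realization_eq_sum, ← Finset.sum_sub_distrib,
        Finset.sum_eq_single i]
      · simp [hA, hi, featureImage_zero hp hσ]
      · intro k _ hk
        simp [hA, hk]
      · simp
    rw [h5, featureImage_smul hσ J ht, smul_comm, smul_smul (θ i).1⁻¹, inv_mul_cancel₀ ha,
      one_smul, smul_smul]
  have hTne {u} (hu : u ≠ 0) : T u ≠ 0 := by
    intro hT
    have h6 : fderiv ℝ (realization J m) θ (A u) = 0 :=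
      (smul_eq_zero.1 hT).resolve_left (inv_ne_zero ha)
    have h7 : A u ∈ range (scalingDirection p θ) := by
      rw [← h2]
      exact h6
    obtain ⟨ξ, hξ⟩ := h7
    have h8 := congrArg Prod.snd (congrFun hξ i)
    simp only [scalingDirection, hi, smul_zero, hA, if_true] at h8
    exact hu h8.symm
  have hp1 : p = 1 :=
    one_eq_of_tendsto_rpow_smul (hTne (u := EuclideanSpace.single ⟨0, hd⟩ 1) (by simp)) (hlim _)
  refine ⟨T, fun u => tendsto_nhds_unique (tendsto_const_nhds.congr' ?_) (hlim u)⟩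
  filter_upwards [self_mem_nhdsWithin] with t ht
  have ht : 0 < t := ht
  rw [hp1, Real.rpow_one, inv_mul_cancel₀ ht.ne', one_smul]

/-- If `wᵢ = 0` the features are linear in the weight, so a motion of `wᵢ` can be compensated by
neuron `j`: through `wⱼ` if that is zero too, through `aⱼ` otherwise. Scalings cannot move `wᵢ = 0`.
-/
theorem inner_ne_zero_of_mem_regularSet (hp : 0 < p) (hd : 0 < d) (hσ : PosHomogeneous p σ)
    {J : featureSpan d σ →ₗ[ℝ] F} {θ : Param m d} (hθ : θ ∈ regularSet p J m) {i j : Fin m}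
    (hij : i ≠ j) : (θ i).2 ≠ 0 := by
  intro hi
  obtain ⟨T, hT⟩ := featureImage_linear_of_inner_eq_zero hp hd hσ hθ hi
  by_cases hj : (θ j).2 = 0
  · have haj : (θ j).1 ≠ 0 := fun h => (((mem_regularSet_iff hp).1 hθ).2.2 j) (Prod.ext h hj)
    let u : EuclideanSpace ℝ (Fin d) := EuclideanSpace.single ⟨0, hd⟩ 1
    obtain ⟨ξ, hξ⟩ := exists_scaling_of_pair hp hθ hij (0, (θ j).1 • u) (0, -(θ i).1 • u)
      fun t => by
        simp only [hT, hi, hj, map_smul, map_zero, mul_zero, add_zero, zero_add, smul_zero]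
        module
    have := congrArg Prod.snd hξ
    simp [hi, haj, u] at this
  · obtain ⟨ξ, hξ⟩ := exists_scaling_of_pair hp hθ hij (0, -(θ j).2) ((θ i).1, 0) fun t => by
      simp only [hT, hi, map_smul, map_neg, map_zero, mul_zero, add_zero, zero_add, smul_zero]
      module
    have := congrArg Prod.snd hξ
    simp [hi, hj] at this

/-- Positively parallel weights have proportional features, so outer weight can be transferred from
one neuron to the other. A scaling that fixes `wᵢ ≠ 0` is trivial and cannot do this. -/
theorem eq_of_direction_eq (hp : 0 < p) (hσ : PosHomogeneous p σ)
    {J : featureSpan d σ →ₗ[ℝ] F} {θ : Param m d} (hθ : θ ∈ regularSet p J m) {i j : Fin m}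
    (hi : (θ i).2 ≠ 0) (hj : (θ j).2 ≠ 0)
    (h : ‖(θ i).2‖⁻¹ • (θ i).2 = ‖(θ j).2‖⁻¹ • (θ j).2) : i = j := by
  by_contra hij
  have hl : 0 < ‖(θ j).2‖ * ‖(θ i).2‖⁻¹ := by positivity
  have hw : (θ j).2 = (‖(θ j).2‖ * ‖(θ i).2‖⁻¹) • (θ i).2 := by
    rw [mul_smul, h, smul_smul, mul_inv_cancel₀ (norm_ne_zero_iff.2 hj), one_smul]
  generalize ‖(θ j).2‖ * ‖(θ i).2‖⁻¹ = l at hl hw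
  obtain ⟨ξ, hξ⟩ := exists_scaling_of_pair hp hθ hij (l ^ p, 0) (-1, 0) fun t => by
    simp only [hw, smul_zero, add_zero, featureImage_smul hσ J hl]
    module
  simp only [Prod.ext_iff] at hξ
  have h0 : ξ = 0 := (smul_eq_zero.1 hξ.2.symm).resolve_right hi
  have := Real.rpow_pos_of_pos hl p
  simp [h0, this.ne'] at hξ

end Regular

/-! ### Topology of the orbit space -/

section OrbitSpaceTopology

variable {m d : ℕ} {p : ℝ} {O : TopologicalSpace.Opens (Param m d)}

/-- Invariance of an open set of parameters under the action. -/
def SymInvariant (p : ℝ) (O : TopologicalSpace.Opens (Param m d)) : Prop :=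
  ∀ (g : SymGroup m), ∀ θ ∈ O, symAct p g θ ∈ O

theorem orbitMk_eq_iff {θ η : O} :
    orbitMk p O θ = orbitMk p O η ↔ ∃ g : SymGroup m, symAct p g (η : Param m d) = θ := by
  exact Quotient.eq (r := orbitSetoid p O)

theorem isQuotientMap_orbitMk : Topology.IsQuotientMap (orbitMk p O) :=
  isQuotientMap_quot_mk

theorem surjective_orbitMk : Function.Surjective (orbitMk p O) :=
  Quotient.mk_surjective

theorem isOpenMap_orbitMk (hO : SymInvariant p O) : IsOpenMap (orbitMk p O) := by
  intro V hV
  rw [← isQuotientMap_orbitMk.isOpen_preimage]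
  have h : orbitMk p O ⁻¹' (orbitMk p O '' V) =
      ⋃ g : SymGroup m, (fun θ : O => (⟨symAct p g θ, hO g θ θ.2⟩ : O)) ⁻¹' V := by
    ext θ
    simp only [mem_preimage, mem_image, mem_iUnion]
    constructor
    · rintro ⟨η, hη, h⟩
      obtain ⟨g, hg⟩ := orbitMk_eq_iff.1 h
      exact ⟨g, by simpa only [hg] using hη⟩
    · rintro ⟨g, hg⟩
      exact ⟨_, hg, orbitMk_eq_iff.2 ⟨g, rfl⟩⟩
  rw [h]
  exact isOpen_iUnion fun g => hV.preimage
    (((continuous_symAct g).comp continuous_subtype_val).subtype_mk _)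

theorem isOpenQuotientMap_orbitMk (hO : SymInvariant p O) : IsOpenQuotientMap (orbitMk p O) :=
  .of_isOpenMap_isQuotientMap (isOpenMap_orbitMk hO) isQuotientMap_orbitMk

theorem secondCountableTopology_orbitSpace (hO : SymInvariant p O) :
    SecondCountableTopology (OrbitSpace p O) :=
  isQuotientMap_orbitMk.secondCountableTopology (isOpenMap_orbitMk hO)

/-- The orbit relation is the range of a proper map, hence closed. As `q` is open, `q × q` is a
quotient map and the diagonal is closed. -/
theorem t2Space_orbitSpace (hO : SymInvariant p O) (h : ProperActionOn p O) :
    T2Space (OrbitSpace p O) := by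
  have hq := (isOpenQuotientMap_orbitMk hO).prodMap (isOpenQuotientMap_orbitMk hO)
  rw [t2_iff_isClosed_diagonal, ← hq.isQuotientMap.isClosed_preimage]
  convert IsClosedMap.isClosed_range (IsProperMap.isClosedMap h)
  ext ⟨x, y⟩
  simp only [mem_preimage, Prod.map_apply, mem_diagonal_iff, mem_range, orbitMk_eq_iff]
  constructor
  · rintro ⟨g, hg⟩
    exact ⟨⟨(g, y), by rw [hg]; exact x.2⟩, Prod.ext (Subtype.ext hg) rfl⟩
  · rintro ⟨⟨⟨g, z⟩, hz⟩, hzx⟩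
    obtain ⟨h1, rfl⟩ := Prod.ext_iff.1 hzx
    exact ⟨g, congrArg Subtype.val h1⟩

end OrbitSpaceTopology

/-! ### Slices for the action and charts of the orbit space -/

/-- A slice for the action on an open set of parameters. -/
structure OrbitSlice {m d : ℕ} (p : ℝ) (O : TopologicalSpace.Opens (Param m d)) where
  source : Set (Param m d)
  isOpen_source : IsOpen source
  source_subset : source ⊆ O
  proj : Param m d → QuotModel m d
  contDiffOn_proj : ContDiffOn ℝ ∞ proj source
  sect : QuotModel m d → Param m d
  contDiff_sect : ContDiff ℝ ∞ sect
  proj_sect : ∀ b, proj (sect b) = b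
  sect_proj_mem : ∀ x ∈ source, sect (proj x) ∈ source
  exists_symAct : ∀ x ∈ source, ∃ g, symAct p g x = sect (proj x)
  proj_symAct : ∀ g, ∀ x ∈ source, symAct p g x ∈ source → proj (symAct p g x) = proj x

namespace OrbitSlice

variable {m d : ℕ} {p : ℝ} {O : TopologicalSpace.Opens (Param m d)} (S : OrbitSlice p O)

open scoped Classical in
/-- The parametrization of the orbit space by the slice. -/
noncomputable def param (x₀ : O) (b : QuotModel m d) : OrbitSpace p O :=
  -- The point `x₀` only supplies a value where the section leaves `O`.
  if h : S.sect b ∈ O then orbitMk p O ⟨S.sect b, h⟩ else orbitMk p O x₀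

variable (x₀ : O)

theorem param_eq {b : QuotModel m d} (hb : S.sect b ∈ S.source) :
    S.param x₀ b = orbitMk p O ⟨S.sect b, S.source_subset hb⟩ := by
  rw [param, dif_pos]

theorem param_proj {x : O} (hx : (x : Param m d) ∈ S.source) :
    S.param x₀ (S.proj x) = orbitMk p O x := by
  rw [S.param_eq x₀ (S.sect_proj_mem x hx), orbitMk_eq_iff]
  exact S.exists_symAct x hx

theorem injOn_param : InjOn (S.param x₀) (S.sect ⁻¹' S.source) := by
  intro b hb b' hb' h
  rw [S.param_eq x₀ hb, S.param_eq x₀ hb', orbitMk_eq_iff] at h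
  obtain ⟨g, hg⟩ := h
  have hg : symAct p g (S.sect b') = S.sect b := hg
  have hb : S.sect b ∈ S.source := hb
  rw [← S.proj_sect b, ← S.proj_sect b', ← hg]
  exact S.proj_symAct g _ hb' (by rwa [hg])

theorem isOpen_preimage_sect : IsOpen (S.sect ⁻¹' S.source) :=
  S.isOpen_source.preimage S.contDiff_sect.continuous

theorem continuousOn_param : ContinuousOn (S.param x₀) (S.sect ⁻¹' S.source) := by
  rw [continuousOn_iff_continuous_domRestrict]
  have h : (S.sect ⁻¹' S.source).domRestrict (S.param x₀) = fun b : S.sect ⁻¹' S.source =>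
      orbitMk p O ⟨S.sect b, S.source_subset b.2⟩ := funext fun b => S.param_eq x₀ b.2
  rw [h]
  exact isQuotientMap_orbitMk.continuous.comp
    ((S.contDiff_sect.continuous.comp continuous_subtype_val).subtype_mk _)

/-- The image of `B` is the `q`-image of the open set of slice points with coordinates in `B`, and
`q` is open. -/
theorem isOpenMap_domRestrict_param (hO : SymInvariant p O) :
    IsOpenMap ((S.sect ⁻¹' S.source).domRestrict (S.param x₀)) := by
  intro V hV
  obtain ⟨B, hB, rfl⟩ := isOpen_induced_iff.1 hV
  have hopen : IsOpen (S.source ∩ S.proj ⁻¹' B) :=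
    S.contDiffOn_proj.continuousOn.isOpen_inter_preimage S.isOpen_source hB
  convert isOpenMap_orbitMk hO _ (hopen.preimage continuous_subtype_val) using 1
  ext y
  constructor
  · rintro ⟨b, hb, rfl⟩
    refine ⟨⟨S.sect b, S.source_subset b.2⟩, ⟨b.2, ?_⟩, (S.param_eq x₀ b.2).symm⟩
    simpa [S.proj_sect] using hb
  · rintro ⟨x, ⟨hx, hxB⟩, rfl⟩
    exact ⟨⟨S.proj x, S.sect_proj_mem x hx⟩, hxB, S.param_proj x₀ hx⟩

/-- The chart of the orbit space given by a slice. -/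
noncomputable def chart (hO : SymInvariant p O) :
    OpenPartialHomeomorph (OrbitSpace p O) (QuotModel m d) :=
  (OpenPartialHomeomorph.ofContinuousOpenRestrict (S.injOn_param x₀).toPartialEquiv
    (S.continuousOn_param x₀) (S.isOpenMap_domRestrict_param x₀ hO) S.isOpen_preimage_sect).symm

variable (hO : SymInvariant p O)

theorem chart_symm_apply {b : QuotModel m d} (hb : S.sect b ∈ S.source) :
    (S.chart x₀ hO).symm b = orbitMk p O ⟨S.sect b, S.source_subset hb⟩ :=
  S.param_eq x₀ hb

theorem orbitMk_mem_chart_source_of_mem {x : O} (hx : (x : Param m d) ∈ S.source) :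
    orbitMk p O x ∈ (S.chart x₀ hO).source :=
  ⟨S.proj x, S.sect_proj_mem x hx, S.param_proj x₀ hx⟩

theorem chart_orbitMk_of_mem {x : O} (hx : (x : Param m d) ∈ S.source) :
    S.chart x₀ hO (orbitMk p O x) = S.proj x := by
  have h := (S.chart x₀ hO).right_inv (x := S.proj x) (S.sect_proj_mem x hx)
  rwa [S.chart_symm_apply x₀ hO (S.sect_proj_mem x hx), ← S.param_eq x₀ (S.sect_proj_mem x hx),
    S.param_proj x₀ hx] at h

theorem chart_orbitMk {x : O} {g : SymGroup m} (hx : symAct p g (x : Param m d) ∈ S.source) :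
    S.chart x₀ hO (orbitMk p O x) = S.proj (symAct p g x) := by
  have h : orbitMk p O x = orbitMk p O ⟨symAct p g x, hO g x x.2⟩ :=
    (orbitMk_eq_iff.2 ⟨g, rfl⟩).symm
  rw [h]
  exact S.chart_orbitMk_of_mem x₀ hO hx

theorem exists_sect_eq_symAct_of_mem_chart_source {x : O}
    (hx : orbitMk p O x ∈ (S.chart x₀ hO).source) :
    ∃ g, symAct p g x = S.sect (S.chart x₀ hO (orbitMk p O x)) ∧
      S.sect (S.chart x₀ hO (orbitMk p O x)) ∈ S.source := by
  have hb := (S.chart x₀ hO).map_source hx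
  have h := (S.chart x₀ hO).left_inv hx
  rw [S.chart_symm_apply x₀ hO hb, orbitMk_eq_iff] at h
  obtain ⟨g, hg⟩ := h
  exact ⟨g, hg, hb⟩

/-- One group element `g`, chosen at `b`, moves the first section into the second slice on a whole
neighbourhood, so the transition map is locally `S'.proj ∘ g ∘ S.sect`. -/
theorem contDiffOn_chart_symm_trans (S' : OrbitSlice p O) (x₁ : O) :
    ContDiffOn ℝ ∞ (S'.chart x₁ hO ∘ (S.chart x₀ hO).symm)
      ((S.chart x₀ hO).symm ≫ₕ S'.chart x₁ hO).source := by
  intro b hb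
  rw [OpenPartialHomeomorph.trans_source] at hb
  obtain ⟨hb1, hb2⟩ := hb
  have hb1 : S.sect b ∈ S.source := hb1
  rw [mem_preimage, S.chart_symm_apply x₀ hO hb1] at hb2
  obtain ⟨g, hg, hg'⟩ := S'.exists_sect_eq_symAct_of_mem_chart_source x₁ hO hb2
  rw [← hg] at hg'
  have hsm : ContDiff ℝ ∞ fun b => symAct p g (S.sect b) :=
    (contDiff_symAct g).comp S.contDiff_sect
  have h1 : ContDiffAt ℝ ∞ (fun b => S'.proj (symAct p g (S.sect b))) b :=
    ContDiffAt.comp b (S'.contDiffOn_proj.contDiffAt (S'.isOpen_source.mem_nhds hg'))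
      hsm.contDiffAt
  refine (h1.congr_of_eventuallyEq ?_).contDiffWithinAt
  filter_upwards [S.isOpen_preimage_sect.mem_nhds hb1,
    hsm.continuous.continuousAt.eventually_mem (S'.isOpen_source.mem_nhds hg')] with y hy1 hy2
  rw [Function.comp_apply, S.chart_symm_apply x₀ hO hy1]
  exact S'.chart_orbitMk x₁ hO hy2

end OrbitSlice

/-! ### Existence of slices -/

section ExistsSlice

variable {m d : ℕ} {p : ℝ}

/-- Coordinates on the product of the neuron slices. -/
noncomputable def quotModelEquiv (m d : ℕ) :
    (Fin m → EuclideanSpace ℝ (Fin d)) ≃L[ℝ] QuotModel m d :=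
  ContinuousLinearEquiv.ofFinrankEq (by simp [Module.finrank_pi_fintype])

/-- The slice assembled from slices for the individual neurons, on an open set `N` of parameters
that is invariant under rescalings and in which points of one orbit have the same coordinates. -/
noncomputable def OrbitSlice.ofNeuronSlices {O : TopologicalSpace.Opens (Param m d)}
    (hO : SymInvariant p O) (S : Fin m → NeuronSlice d p) (N : Set (Param m d)) (hN : IsOpen N)
    (hscale : ∀ x ∈ N, ∀ c : Fin m → ℝ, (∀ i, 0 < c i) → (fun i => neuronScale p (c i) (x i)) ∈ N)
    (hperm : ∀ g, ∀ x ∈ N, (∀ i, x i ∈ (S i).source) → symAct p g x ∈ N →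
      (∀ i, symAct p g x i ∈ (S i).source) →
      ∀ i, (S i).proj (symAct p g x i) = (S i).proj (x i)) : OrbitSlice p O :=
  -- Normalizing all neurons at once is a pure rescaling, under which both `O` and `N` are stable.
  have key : ∀ x : Param m d, (∀ i, x i ∈ (S i).source) → ∃ c : Fin m → ℝ, (∀ i, 0 < c i) ∧
      (fun i => neuronScale p (c i) (x i)) = fun i => (S i).sect ((S i).proj (x i)) := by
    intro x hx
    choose c hc h using fun i => (S i).exists_scale (x i) (hx i)
    exact ⟨c, hc, funext h⟩
  have act : ∀ (x : Param m d) (c : Fin m → ℝ) (hc : ∀ i, 0 < c i),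
      symAct p (SemidirectProduct.inl fun i => ⟨c i, hc i⟩) x =
        fun i => neuronScale p (c i) (x i) := fun x c hc => funext fun i => symAct_inl _ _ _
  { source := O ∩ (N ∩ ⋂ i, (fun x : Param m d => x i) ⁻¹' (S i).source)
    isOpen_source := O.isOpen.inter (hN.inter (isOpen_iInter_of_finite fun i =>
      (S i).isOpen_source.preimage (continuous_apply i)))
    source_subset := inter_subset_left
    proj := fun x => quotModelEquiv m d fun i => (S i).proj (x i)
    contDiffOn_proj := by
      refine (quotModelEquiv m d).contDiff.comp_contDiffOn (contDiffOn_pi.2 fun i => ?_)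
      exact (S i).contDiffOn_proj.comp (contDiff_apply ℝ _ i).contDiffOn
        fun x hx => mem_iInter.1 hx.2.2 i
    sect := fun b i => (S i).sect ((quotModelEquiv m d).symm b i)
    contDiff_sect := contDiff_pi.2 fun i => (S i).contDiff_sect.comp
      ((contDiff_apply ℝ _ i).comp (quotModelEquiv m d).symm.contDiff)
    proj_sect := fun b => by simp [NeuronSlice.proj_sect]
    sect_proj_mem := fun x hx => by
      obtain ⟨c, hc, h⟩ := key x (mem_iInter.1 hx.2.2)
      simp only [ContinuousLinearEquiv.symm_apply_apply]
      refine ⟨?_, ?_, mem_iInter.2 fun i => (S i).sect_mem _⟩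
      · rw [← h, ← act x c hc]
        exact hO _ _ hx.1
      · rw [← h]
        exact hscale x hx.2.1 c hc
    exists_symAct := fun x hx => by
      obtain ⟨c, hc, h⟩ := key x (mem_iInter.1 hx.2.2)
      exact ⟨_, by simp only [ContinuousLinearEquiv.symm_apply_apply]; rw [← h, ← act x c hc]⟩
    proj_symAct := fun g x hx hgx => by
      congr 1
      funext i
      exact hperm g x hx.2.1 (mem_iInter.1 hx.2.2) hgx.2.1 (mem_iInter.1 hgx.2.2) i }

theorem symAct_apply_of_right_eq_one {g : SymGroup m} (hg : g.right = 1) (x : Param m d)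
    (i : Fin m) : symAct p g x i = neuronScale p (g.left i) (x i) := by
  simp [symAct_apply, hg]

theorem NeuronSlice.proj_symAct_of_right_eq_one {g : SymGroup m} (hg : g.right = 1)
    {x : Param m d} {i : Fin m} (S : NeuronSlice d p) (hx : x i ∈ S.source) :
    S.proj (symAct p g x i) = S.proj (x i) := by
  rw [symAct_apply_of_right_eq_one hg]
  exact S.proj_scale _ (g.left i).2 _ hx

theorem direction_neuronScale {c : ℝ} (hc : 0 < c) (x : ℝ × EuclideanSpace ℝ (Fin d)) :
    ‖(neuronScale p c x).2‖⁻¹ • (neuronScale p c x).2 = ‖x.2‖⁻¹ • x.2 := by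
  simp only [neuronScale, norm_smul, Real.norm_eq_abs, abs_of_pos hc, smul_smul]
  congr 1
  field_simp

theorem exists_orbitSlice_of_direction (hp : 0 < p) {O : TopologicalSpace.Opens (Param m d)}
    (hO : SymInvariant p O) {θ : Param m d} (hθ : θ ∈ O) (hne : ∀ i, θ i ≠ 0)
    (hdir : 0 < d → ∀ i j, i ≠ j → (θ i).2 ≠ 0 ∧
      ‖(θ i).2‖⁻¹ • (θ i).2 ≠ ‖(θ j).2‖⁻¹ • (θ j).2) :
    ∃ S : OrbitSlice p O, θ ∈ S.source := by
  choose S hS using fun i => exists_neuronSlice hp (hne i)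
  -- Here permutations do no harm: either the coordinates lie in a one-point space or there is no
  -- nontrivial permutation.
  by_cases htriv : d = 0 ∨ Subsingleton (Fin m)
  · refine ⟨OrbitSlice.ofNeuronSlices hO S univ isOpen_univ (fun _ _ _ _ => mem_univ _) ?_,
      hθ, mem_univ _, mem_iInter.2 hS⟩
    intro g x _ hx _ _ i
    rcases htriv with rfl | h
    · exact Subsingleton.elim _ _
    · exact (S i).proj_symAct_of_right_eq_one (Subsingleton.elim _ _) (hx i)
  · obtain ⟨hd, hm⟩ := not_or.1 htriv
    have hm : Nontrivial (Fin m) := not_subsingleton_iff_nontrivial.1 hm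
    replace hdir := hdir (Nat.pos_of_ne_zero hd)
    have hw (i : Fin m) : (θ i).2 ≠ 0 := by
      obtain ⟨j, hj⟩ := exists_ne i
      exact (hdir i j hj.symm).1
    let dir : ℝ × EuclideanSpace ℝ (Fin d) → EuclideanSpace ℝ (Fin d) := fun x => ‖x.2‖⁻¹ • x.2
    -- Disjoint neighbourhoods of the finitely many directions label the neurons. Rescaling keeps
    -- directions, so a group element that keeps all labels has trivial permutation part.
    obtain ⟨V, hV, hVd⟩ := (finite_range fun i => dir (θ i)).t2_separation
    let A : Fin m → Set (ℝ × EuclideanSpace ℝ (Fin d)) := fun i =>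
      {x | x.2 ≠ 0} ∩ dir ⁻¹' V (dir (θ i))
    have hA (i : Fin m) : IsOpen (A i) := by
      refine ContinuousOn.isOpen_inter_preimage ?_ ?_ (hV _).2
      · exact ContinuousOn.smul (ContinuousOn.inv₀ (by fun_prop) fun x hx => norm_ne_zero_iff.2 hx)
          (by fun_prop)
      · exact isOpen_ne_fun continuous_snd continuous_const
    have hAs (i : Fin m) {c : ℝ} (hc : 0 < c) (x) :
        neuronScale p c x ∈ A i ↔ x ∈ A i := by
      have h1 : dir (neuronScale p c x) = dir x := direction_neuronScale hc x
      have h2 : (neuronScale p c x).2 ≠ 0 ↔ x.2 ≠ 0 := by simp [neuronScale, hc.ne']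
      exact and_congr h2 (by rw [mem_preimage, h1, mem_preimage])
    refine ⟨OrbitSlice.ofNeuronSlices hO S (⋂ i, (fun x : Param m d => x i) ⁻¹' A i)
      (isOpen_iInter_of_finite fun i => (hA i).preimage (continuous_apply i)) ?_ ?_,
      hθ, mem_iInter.2 fun i => ⟨hw i, (hV _).1⟩, mem_iInter.2 hS⟩
    · intro x hx c hc
      exact mem_iInter.2 fun i => (hAs i (hc i) _).2 (mem_iInter.1 hx i)
    · intro g x hx hxS hgx _ i
      refine (S i).proj_symAct_of_right_eq_one ?_ (hxS i)
      rw [← inv_eq_one]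
      ext k
      congr 1
      have h1 := (hAs k (g.left k).2 _).1 (mem_iInter.1 hgx k)
      have h2 := mem_iInter.1 hx (g.right⁻¹ k)
      by_contra hne
      have h3 : dir (θ (g.right⁻¹ k)) ≠ dir (θ k) := (hdir _ _ hne).2
      exact (hVd ⟨_, rfl⟩ ⟨_, rfl⟩ h3).le_bot ⟨h2.2, h1.2⟩

end ExistsSlice

/-! ### The quotient manifold -/

theorem HasFDerivAt.hasMFDerivAt_opens {E' E : Type*} [NormedAddCommGroup E'] [NormedSpace ℝ E']
    [NormedAddCommGroup E] [NormedSpace ℝ E] {O : TopologicalSpace.Opens E} {f : E' → O}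
    {f' : E' →L[ℝ] E} {x : E'} (h : HasFDerivAt (fun y => (f y : E)) f' x) :
    HasMFDerivAt 𝓘(ℝ, E') 𝓘(ℝ, E) f x f' := by
  refine ⟨Topology.IsInducing.subtypeVal.continuousAt_iff.2 h.continuousAt, ?_⟩
  simpa only [mfld_simps] using! h.hasFDerivWithinAt

section QuotientManifold

variable {m d : ℕ} {p : ℝ} {O : TopologicalSpace.Opens (Param m d)}

/-- The atlas of the orbit space given by slices through every point. -/
noncomputable abbrev orbitChartedSpace (hO : SymInvariant p O) (S : O → OrbitSlice p O)
    (hS : ∀ θ : O, (θ : Param m d) ∈ (S θ).source) :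
    ChartedSpace (QuotModel m d) (OrbitSpace p O) where
  atlas := range fun θ => (S θ).chart θ hO
  chartAt x := (S (Function.surjInv surjective_orbitMk x)).chart _ hO
  mem_chart_source x := by
    have h := (S (Function.surjInv surjective_orbitMk x)).orbitMk_mem_chart_source_of_mem
      (Function.surjInv surjective_orbitMk x) hO (hS _)
    rwa [Function.surjInv_eq surjective_orbitMk x] at h
  chart_mem_atlas x := ⟨_, rfl⟩

theorem isManifold_orbitChartedSpace (hO : SymInvariant p O) (S : O → OrbitSlice p O)
    (hS : ∀ θ : O, (θ : Param m d) ∈ (S θ).source) :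
    letI := orbitChartedSpace hO S hS
    IsManifold 𝓘(ℝ, QuotModel m d) ∞ (OrbitSpace p O) := by
  let _ := orbitChartedSpace hO S hS
  refine isManifold_of_contDiffOn _ _ _ ?_
  rintro _ _ ⟨θ, rfl⟩ ⟨η, rfl⟩
  simpa only [mfld_simps] using (S θ).contDiffOn_chart_symm_trans θ hO (S η) η

/-- Near `θ` the quotient map is the inverse chart after the slice projection, hence smooth. It is a
submersion because it has a smooth local section through `θ`. -/
theorem isQuotientManifold_orbitChartedSpace (hO : SymInvariant p O) (S : O → OrbitSlice p O)
    (hS : ∀ θ : O, (θ : Param m d) ∈ (S θ).source) :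
    letI := orbitChartedSpace hO S hS
    IsQuotientManifold p O := by
  let _ := orbitChartedSpace hO S hS
  have hM := isManifold_orbitChartedSpace hO S hS
  have hq : ContMDiff 𝓘(ℝ, Param m d) 𝓘(ℝ, QuotModel m d) ∞ (orbitMk p O) := by
    intro θ
    let e := (S θ).chart θ hO
    have he : e ∈ atlas (QuotModel m d) (OrbitSpace p O) := ⟨θ, rfl⟩
    have h1 : ContMDiffAt 𝓘(ℝ, QuotModel m d) 𝓘(ℝ, QuotModel m d) ∞ e.symm ((S θ).proj θ) :=
      (contMDiffOn_symm_of_mem_maximalAtlas (IsManifold.subset_maximalAtlas he)).contMDiffAt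
        (e.open_target.mem_nhds ((S θ).sect_proj_mem θ (hS θ)))
    have h2 : ContMDiffAt 𝓘(ℝ, Param m d) 𝓘(ℝ, QuotModel m d) ∞
        (fun x : O => (S θ).proj (x : Param m d)) θ :=
      ContMDiffAt.comp θ ((S θ).contDiffOn_proj.contDiffAt
        ((S θ).isOpen_source.mem_nhds (hS θ))).contMDiffAt contMDiff_subtype_val.contMDiffAt
    refine (h1.comp θ h2).congr_of_eventuallyEq ?_
    filter_upwards [((S θ).isOpen_source.preimage continuous_subtype_val).mem_nhds (hS θ)] with x hx
    exact ((S θ).param_proj θ hx).symm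
  refine ⟨hM, hq, fun θ => ?_⟩
  let e := (S θ).chart θ hO
  have he : e ∈ atlas (QuotModel m d) (OrbitSpace p O) := ⟨θ, rfl⟩
  let b := (S θ).proj θ
  have hb : (S θ).sect b ∈ (S θ).source := (S θ).sect_proj_mem θ (hS θ)
  obtain ⟨g, hg⟩ := (S θ).exists_symAct θ (hS θ)
  have hback : symAct p g⁻¹ ((S θ).sect b) = θ := by rw [← hg, symAct_inv_symAct]
  have hsm : ContDiff ℝ ∞ fun y => symAct p g⁻¹ ((S θ).sect y) :=
    (contDiff_symAct g⁻¹).comp (S θ).contDiff_sect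
  classical
  -- The slice section moved back by `g⁻¹` so that it passes through `θ` itself; composed with `q`
  -- it is the inverse chart, whose derivative is onto.
  let τ : QuotModel m d → O := fun y =>
    if h : symAct p g⁻¹ ((S θ).sect y) ∈ O then ⟨_, h⟩ else θ
  have hev : ∀ᶠ y in 𝓝 b, (S θ).sect y ∈ (S θ).source :=
    (S θ).isOpen_preimage_sect.mem_nhds hb
  have hτ : ∀ᶠ y in 𝓝 b, ((τ y : O) : Param m d) = symAct p g⁻¹ ((S θ).sect y) := by
    filter_upwards [hev] with y hy
    simp only [τ]
    rw [dif_pos (hO _ _ ((S θ).source_subset hy))]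
  have hτb : τ b = θ := Subtype.ext (hτ.self_of_nhds.trans hback)
  have h1 : HasMFDerivAt 𝓘(ℝ, QuotModel m d) 𝓘(ℝ, Param m d) τ b
      (fderiv ℝ (fun y => symAct p g⁻¹ ((S θ).sect y)) b) :=
    HasFDerivAt.hasMFDerivAt_opens
      (((hsm.differentiable (by simp)).differentiableAt.hasFDerivAt).congr_of_eventuallyEq hτ)
  have h2 : MDifferentiableAt 𝓘(ℝ, Param m d) 𝓘(ℝ, QuotModel m d) (orbitMk p O) (τ b) :=
    hq.mdifferentiable (by simp) _
  have h3 := h2.hasMFDerivAt.comp b h1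
  have h4 : orbitMk p O ∘ τ =ᶠ[𝓝 b] e.symm := by
    filter_upwards [hev, hτ] with y hy hτy
    rw [Function.comp_apply, (S θ).chart_symm_apply θ hO hy, orbitMk_eq_iff]
    exact ⟨g⁻¹, hτy.symm⟩
  have h5 := (h3.congr_of_eventuallyEq h4.symm).mfderiv
  have hM1 : IsManifold 𝓘(ℝ, QuotModel m d) 1 (OrbitSpace p O) := IsManifold.of_le (n := ∞) (by simp)
  have h6 : Function.Surjective (mfderiv 𝓘(ℝ, QuotModel m d) 𝓘(ℝ, QuotModel m d) e.symm b) :=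
    (mdifferentiable_of_mem_atlas he).symm.mfderiv_surjective hb
  rw [h5] at h6
  rw [← hτb]
  exact Function.Surjective.of_comp h6

theorem exists_isQuotientManifold (hO : SymInvariant p O)
    (h : ∀ θ ∈ O, ∃ S : OrbitSlice p O, θ ∈ S.source) :
    ∃ _ : ChartedSpace (QuotModel m d) (OrbitSpace p O), IsQuotientManifold p O := by
  choose S hS using fun θ : O => h θ θ.2
  exact ⟨orbitChartedSpace hO S hS, isQuotientManifold_orbitChartedSpace hO S hS⟩

theorem mfderiv_orbitMk_eq_zero_of_curve [ChartedSpace (QuotModel m d) (OrbitSpace p O)]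
    (h : IsQuotientManifold p O) {γ : ℝ → O} {v : Param m d}
    (hγ : HasDerivAt (fun t => (γ t : Param m d)) v 0)
    (hc : ∀ t, orbitMk p O (γ t) = orbitMk p O (γ 0)) :
    mfderiv 𝓘(ℝ, Param m d) 𝓘(ℝ, QuotModel m d) (orbitMk p O) (γ 0) v = 0 := by
  have h1 : HasMFDerivAt 𝓘(ℝ, ℝ) 𝓘(ℝ, Param m d) γ 0 (ContinuousLinearMap.toSpanSingleton ℝ v) :=
    HasFDerivAt.hasMFDerivAt_opens hγ.hasFDerivAt
  have h2 : MDifferentiableAt 𝓘(ℝ, Param m d) 𝓘(ℝ, QuotModel m d) (orbitMk p O) (γ 0) :=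
    h.2.1.mdifferentiable (by simp) _
  have h3 := h2.hasMFDerivAt.comp 0 h1
  have h4 : HasMFDerivAt 𝓘(ℝ, ℝ) 𝓘(ℝ, QuotModel m d) (orbitMk p O ∘ γ) 0
      (0 : TangentSpace 𝓘(ℝ, ℝ) (0 : ℝ) →L[ℝ] TangentSpace 𝓘(ℝ, QuotModel m d) _) :=
    (hasMFDerivAt_const (orbitMk p O (γ 0)) 0).congr_of_eventuallyEq (.of_forall hc)
  have h5 := DFunLike.congr_fun (hasMFDerivAt_unique h3 h4) (1 : ℝ)
  have h6 : ContinuousLinearMap.toSpanSingleton ℝ v (1 : ℝ) = v := by simp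
  calc _ = mfderiv 𝓘(ℝ, Param m d) 𝓘(ℝ, QuotModel m d) (orbitMk p O) (γ 0)
        (ContinuousLinearMap.toSpanSingleton ℝ v (1 : ℝ)) := by rw [h6]
    _ = 0 := h5

theorem mfderiv_orbitMk_scalingDirection [ChartedSpace (QuotModel m d) (OrbitSpace p O)]
    (hO : SymInvariant p O) (h : IsQuotientManifold p O) (θ : O) (ξ : Fin m → ℝ) :
    mfderiv 𝓘(ℝ, Param m d) 𝓘(ℝ, QuotModel m d) (orbitMk p O) θ
      (scalingDirection p (θ : Param m d) ξ) = 0 := by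
  let γ : ℝ → O := fun t => ⟨scalingCurve p θ ξ t, by
    rw [scalingCurve_eq_symAct]
    exact hO _ _ θ.2⟩
  have h0 : γ 0 = θ := Subtype.ext (scalingCurve_zero _ _)
  have h1 := mfderiv_orbitMk_eq_zero_of_curve h (γ := γ)
    (hasDerivAt_scalingCurve (θ : Param m d) ξ) fun t => by
      rw [h0]
      exact orbitMk_eq_iff.2 ⟨_, (scalingCurve_eq_symAct _ _ _).symm⟩
  rwa [h0] at h1

/-- Scaling curves have constant image under `q`, which gives one inclusion. Equality is the count
`m (d + 1) - m d = m`, so any quotient structure will do. -/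
theorem ker_mfderiv_orbitMk [ChartedSpace (QuotModel m d) (OrbitSpace p O)] (hp : 0 < p)
    (hO : SymInvariant p O) (h : IsQuotientManifold p O) {θ : O}
    (hθ : ∀ i, (θ : Param m d) i ≠ 0) (v : Param m d) :
    mfderiv 𝓘(ℝ, Param m d) 𝓘(ℝ, QuotModel m d) (orbitMk p O) θ v = 0 ↔
      v ∈ LinearMap.range (scalingMap p (θ : Param m d)) := by
  let D : Param m d →L[ℝ] QuotModel m d :=
    mfderiv 𝓘(ℝ, Param m d) 𝓘(ℝ, QuotModel m d) (orbitMk p O) θ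
  have hD : Function.Surjective D := h.2.2 θ
  have h1 := D.toLinearMap.finrank_range_add_finrank_ker
  rw [LinearMap.range_eq_top.2 hD, finrank_top] at h1
  have h2 : Module.finrank ℝ (LinearMap.ker D.toLinearMap) = m := by
    have h3 : Module.finrank ℝ (QuotModel m d) = m * d := by simp
    have h4 : Module.finrank ℝ (Param m d) = m * (1 + d) := by simp [Module.finrank_pi_fintype]
    rw [h3, h4] at h1
    linarith
  have hle : LinearMap.range (scalingMap p (θ : Param m d)) ≤ LinearMap.ker D.toLinearMap := by
    rintro _ ⟨ξ, rfl⟩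
    exact mfderiv_orbitMk_scalingDirection hO h θ ξ
  rw [Submodule.eq_of_le_of_finrank_eq hle (by rw [h2, finrank_range_scalingMap hp hθ])]
  rfl

end QuotientManifold

/-! ### The canonical isomorphism and the main theorem -/

theorem existsUnique_linearEquiv_range {V W F : Type*} [AddCommGroup V] [Module ℝ V]
    [AddCommGroup W] [Module ℝ W] [AddCommGroup F] [Module ℝ F] (A : V →ₗ[ℝ] W) (B : V →ₗ[ℝ] F)
    (hA : Function.Surjective A) (hker : LinearMap.ker A = LinearMap.ker B) :
    ∃! L : W ≃ₗ[ℝ] LinearMap.range B, ∀ v, (L (A v) : F) = B v := by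
  let L₀ : W ≃ₗ[ℝ] LinearMap.range B := (A.quotKerEquivOfSurjective hA).symm ≪≫ₗ
    Submodule.quotEquivOfEq _ _ hker ≪≫ₗ B.quotKerEquivRange
  have h₀ : ∀ v, (L₀ (A v) : F) = B v := by
    intro v
    have h : (A.quotKerEquivOfSurjective hA).symm (A v) = Submodule.Quotient.mk v := by
      rw [LinearEquiv.symm_apply_eq]
      rfl
    simp only [L₀, LinearEquiv.trans_apply, h]
    rfl
  refine ⟨L₀, h₀, fun L hL => LinearEquiv.ext fun w => ?_⟩
  obtain ⟨v, rfl⟩ := hA w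
  exact Subtype.ext ((hL v).trans (h₀ v).symm)

theorem mainTheorem6 (m d : ℕ) (p : ℝ) (hp : 0 < p) (σ : ℝ → ℝ) (hσ : PosHomogeneous p σ)
    {F : Type*} [AddCommGroup F] [Module ℝ F] [TopologicalSpace F] [IsTopologicalAddGroup F]
    [ContinuousSMul ℝ F] [T2Space F] (J : featureSpan d σ →ₗ[ℝ] F) :
    (∀ θ ∈ regularSet p J m,
      {v | fderiv ℝ (realization J m) θ v = 0} = orbitTangent p θ ∧
      orbitTangent p θ = Set.range (scalingDirection p θ)) ∧
    (∀ (g : SymGroup m), ∀ θ ∈ regularSet p J m, symAct p g θ ∈ regularSet p J m) ∧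
    ((∃ U : Set (Param m d), IsOpen U ∧ regularSet p J m ⊆ U ∧
        ContinuouslyDifferentiableOn (realization J m) U) →
      ∃ O : TopologicalSpace.Opens (Param m d), (O : Set (Param m d)) = regularSet p J m ∧
        SecondCountableTopology (OrbitSpace p O) ∧
        (ProperActionOn p O → T2Space (OrbitSpace p O)) ∧
        (∃ _ : ChartedSpace (QuotModel m d) (OrbitSpace p O), IsQuotientManifold p O) ∧
        ∀ _ : ChartedSpace (QuotModel m d) (OrbitSpace p O), IsQuotientManifold p O →
          ∀ θ : O, ∃! L : TangentSpace 𝓘(ℝ, QuotModel m d) (orbitMk p O θ) ≃ₗ[ℝ]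
              LinearMap.range (fderiv ℝ (realization J m) (θ : Param m d)).toLinearMap,
            ∀ v : Param m d,
              (L (mfderiv 𝓘(ℝ, Param m d) 𝓘(ℝ, QuotModel m d) (orbitMk p O) θ v) : F) =
                fderiv ℝ (realization J m) (θ : Param m d) v) := by
  refine ⟨fun θ hθ => ⟨hθ.2.1, orbitTangent_eq_range hp ((mem_regularSet_iff hp).1 hθ).2.2⟩,
    fun g θ hθ => symAct_mem_regularSet hp hσ J g hθ, ?_⟩
  rintro ⟨U, hU, hsub, hC⟩
  let O : TopologicalSpace.Opens (Param m d) :=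
    ⟨regularSet p J m, isOpen_regularSet hp hσ J hU hsub hC⟩
  have hO : SymInvariant p O := fun g θ hθ => symAct_mem_regularSet hp hσ J g hθ
  refine ⟨O, rfl, secondCountableTopology_orbitSpace hO, t2Space_orbitSpace hO,
    exists_isQuotientManifold hO fun θ hθ => ?_, fun _ hQ θ => ?_⟩
  · refine exists_orbitSlice_of_direction hp hO hθ ((mem_regularSet_iff hp).1 hθ).2.2 ?_
    intro hd i j hij
    have hi := inner_ne_zero_of_mem_regularSet hp hd hσ hθ hij
    have hj := inner_ne_zero_of_mem_regularSet hp hd hσ hθ hij.symm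
    exact ⟨hi, fun h => hij (eq_of_direction_eq hp hσ hθ hi hj h)⟩
  · obtain ⟨-, hker, hne⟩ := (mem_regularSet_iff hp).1 θ.2
    -- At `θ` both `Dq` and `DΦ` have the scaling directions as kernel.
    refine existsUnique_linearEquiv_range
      (mfderiv 𝓘(ℝ, Param m d) 𝓘(ℝ, QuotModel m d) (orbitMk p O) θ).toLinearMap _ (hQ.2.2 θ) ?_
    ext v
    exact (ker_mfderiv_orbitMk hp hO hQ hne v).trans (Set.ext_iff.1 hker v).symm
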